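/- **Setting.** Let $\mathcal V$ be an operator space (a linear subspace of a unital $C^*$-algebra $\mathcal A$; matrices over $\mathcal V$ carry the norm and the adjoint of matrices over $\mathcal A$), and let $\mathcal J,\mathcal K$ be unital $C^*$-algebras, $\mathcal K\ne0$. A noncommutative (nc) set over $\mathcal V$ is a family $\mathcal O=(\mathcal O_n)_{n}$ with $\mathcal O_n\subseteq\mathcal V^{n\times n}$ that is closed under direct sums. An affine nc kernel $G$ on $\mathcal O$ assigns to $a\in\mathcal O_m$, $c\in\mathcal O_n$ a linear map $G(a,c)\colon\mathcal J^{m\times n}\to\mathcal K^{m\times n}$ such that $S\,G(a,c)(P)\,T=G(\tilde a,\tilde c)(SPT)$ whenever $a,\tilde a,c,\tilde c$ are points of $\mathcal O$ and $S,T$ are complex matrices with $Sa=\tilde aS$, $cT=T\tilde c$. Assume: * $\mathcal O$ is uniformly open and $G$ is locally uniformly bounded, or $\mathcal O$ is finitely open and $G$ is locally bounded on slices, or $\mathcal O$ is open at each level and $G$ is locally bounded on slices; * $G(a,c)(v)^*=G(c^*,a^*)(v)$ whenever $v=v^*\in\mathcal J^{n\times n}$ and $a,c,a^*,c^*\in\mathcal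 O_n$; * there is $a_0$ at level $1$ in $\{a\in\mathcal O: a^*\in\mathcal O,\ G(a,a^*)(1)>0\}$, where $x>0$ means that $x$ is positive and invertible. Let $\mathcal D_{G,k}$ be the connected component (in the norm topology) of $a_0\otimes 1_k$ in $\{a\in\mathcal O_k: a^*\in\mathcal O_k,\ G(a,a^*)(1)>0\}$ and $\mathcal D_G=(\mathcal D_{G,k})_k$. Let $\mathcal D_H$ be defined in the same way from an affine nc kernel $H$, with values in linear maps between matrices over two further unital $C^*$-algebras, on an nc set $\mathcal O'$ over an operator space $\mathcal W$, with the same properties. Let $f\colon\mathcal D_G\to\mathcal D_H$ be an nc map, i.e. $f$ preserves levels and $aS=Sc$ implies $f(a)S=Sf(c)$ for all complex matrices $S$ and $a,c\in\mathcal D_G$. For an nc set $\mathcal D$, $a\in\mathcal D_n$, $c\in\mathcal D_m$, $b\in\mathcal V^{n\times m}$ put $$\delta_{\mathcal D}(a,c)(b)=\Bigl[\sup\Bigl\{t\in[0,\infty]:\begin{bmatrix}a&sb\\0&c\end{bmatrix}\in\mathcal D_{n+m}\text{ for all finite } s\in[0,t]\Bigr\}\Bigr]^{-1}\in[0,\infty],$$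 and $\tilde\delta_{\mathcal D}(a,c)=\delta_{\mathcal D}(a,c)(a-c)$ if $m=n$. The difference-differentials are given by $f\left(\begin{bmatrix}a&b\\0&c\end{bmatrix}\right)=\begin{bmatrix}f(a)&\Delta f(a,c)(b)\\0&f(c)\end{bmatrix}$, $$G\left(\begin{bmatrix}a&b\\0&a'\end{bmatrix},c\right)\begin{bmatrix}P_1\\P_2\end{bmatrix}=\begin{bmatrix}G(a,c)(P_1)+{}_0\Delta G(a;a',c)(b,P_2)\\G(a',c)(P_2)\end{bmatrix},$$ $$G\left(a,\begin{bmatrix}c&b\\0&c'\end{bmatrix}\right)\begin{bmatrix}P_1&P_2\end{bmatrix}=\begin{bmatrix}G(a,c)(P_1)&{}_1\Delta G(a,c;c')(P_1,b)+G(a,c')(P_2)\end{bmatrix},$$ extended by homogeneity to all $b$, and ${}_1\Delta{}_0\Delta G(a;a',c;c')(b,P,b')$ is ${}_1\Delta$ applied to ${}_0\Delta G(a;a',\cdot)(b,\cdot)$. For $a,c\in\mathcal D_{G,n}$ write $$\Pi_G(a,c)=G(a,a^*)(1)^{-\frac12}G(a,c^*)(1)G(c,c^*)(1)^{-1}G(c,a^*)(1)G(a,a^*)(1)^{-\frac12},$$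 and similarly $\Pi_H$. Say that $G$ is *triangularly defined over* $\mathcal D_G$ if for all $n,m$, $a\in\mathcal D_{G,n}$, $c\in\mathcal D_{G,m}$, $b\in\mathcal V^{n\times m}$ the matrix $\begin{bmatrix}a&b\\0&c\end{bmatrix}$ and its adjoint belong to $\mathcal O_{n+m}$; similarly for $H$. **Proposition.** 1. If $G$ is triangularly defined over $\mathcal D_G$, then for all $a\in\mathcal D_{G,n},c\in\mathcal D_{G,m},b\in\mathcal V^{n\times m}$ $$\delta_{\mathcal D_G}(a,c)(b)=\max\Bigl\{0,\sup\sigma\Bigl(G(a,a^*)(1)^{-\frac12}\bigl[{}_0\Delta G(a;c,c^*)(b,1)\,G(c,c^*)(1)^{-1}\,{}_1\Delta G(c,c^*;a^*)(1,b^*)-{}_1\Delta{}_0\Delta G(a;c,c^*;a^*)(b,1,b^*)\bigr]G(a,a^*)(1)^{-\frac12}\Bigr)\Bigr\}^{\frac12},$$ and, if $m=n$, $\tilde\delta_{\mathcal D_G}(a,c)=\max\{0,\sup\sigma(\Pi_G(a,c)-1)\}^{1/2}$. The same holds for $H$. 2. For all $a\in\mathcal D_{G,n},c\in\mathcal D_{G,m},b\in\mathcal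 V^{n\times m}$: $\ \delta_{\mathcal D_H}(f(a),f(c))(\Delta f(a,c)(b))\le\delta_{\mathcal D_G}(a,c)(b)$. 3. For all $a,c\in\mathcal D_{G,n}$: $\ \tilde\delta_{\mathcal D_H}(f(a),f(c))\le\tilde\delta_{\mathcal D_G}(a,c)$. 4. If $G$ is triangularly defined over $\mathcal D_G$, then for all $a,c\in\mathcal D_{G,n}$: $\ \|\Pi_H(f(a),f(c))\|\le\max\{1,\|\Pi_G(a,c)\|\}$, and $$\|\Pi_H(f(a),f(c))\|\le\|\Pi_G(a,c)\|$$ whenever $a=c$ or $\tilde\delta_{\mathcal D_G}(a,c)\neq0$ (in particular for all $a,c$ if $\mathcal D_G$ contains no complex lines). 5. If $G$ is triangularly defined over $\mathcal D_G$, then for all $a,c\in\mathcal D_{G,n}$ $$H(f(a),f(c)^*)(1)\,H(f(c),f(c)^*)(1)^{-1}\,H(f(c),f(a)^*)(1)-H(f(a),f(a)^*)(1)\le\|\Pi_G(a,c)-1\|\,H(f(a),f(a)^*)(1).$$ -/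

import Mathlib

open scoped Matrix ENNReal NNReal

noncomputable section

namespace NCKernel

/-- A family of sets of square matrices over `A`, one for each level `n`.
(Level `0` is allowed to be empty, so levels `1, 2, …` are a special case.) -/
abbrev NCFamily (A : Type*) := ∀ n : ℕ, Set (Matrix (Fin n) (Fin n) A)

/-- A two-variable family `G(a, c) : J^{m × n} → K^{m × n}` of linear maps, `a ∈ A^{m × m}`,
`c ∈ A^{n × n}`. Only its values at points of a given nc set are ever used. -/
abbrev KernelFamily (A J K : Type*) [AddCommMonoid J] [Module ℂ J] [AddCommMonoid K]
    [Module ℂ K] :=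
  ∀ m n : ℕ, Matrix (Fin m) (Fin m) A → Matrix (Fin n) (Fin n) A →
    (Matrix (Fin m) (Fin n) J →ₗ[ℂ] Matrix (Fin m) (Fin n) K)

/-- A complex matrix seen as a matrix over the unital algebra `A`. -/
def scalarMat (A : Type*) [Semiring A] [Algebra ℂ A] {m n : ℕ} (S : Matrix (Fin m) (Fin n) ℂ) :
    Matrix (Fin m) (Fin n) A :=
  S.map (algebraMap ℂ A)

/-- The block upper triangular matrix `[a b; 0 c]`. -/
def blk {A : Type*} [Zero A] {n m : ℕ} (a : Matrix (Fin n) (Fin n) A)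
    (b : Matrix (Fin n) (Fin m) A) (c : Matrix (Fin m) (Fin m) A) :
    Matrix (Fin (n + m)) (Fin (n + m)) A :=
  Matrix.reindex finSumFinEquiv finSumFinEquiv (Matrix.fromBlocks a b 0 c)

/-- The matrix `[0; P]` with `n` zero rows put on top of `P`. -/
def zeroTop {J : Type*} [Zero J] (n : ℕ) {m k : ℕ} (P : Matrix (Fin m) (Fin k) J) :
    Matrix (Fin (n + m)) (Fin k) J :=
  (Matrix.fromRows (0 : Matrix (Fin n) (Fin k) J) P).submatrix finSumFinEquiv.symm id

/-- The matrix `[P 0]` with `l` zero columns put to the right of `P`. -/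
def zeroRight {J : Type*} [Zero J] (l : ℕ) {n k : ℕ} (P : Matrix (Fin n) (Fin k) J) :
    Matrix (Fin n) (Fin (k + l)) J :=
  (Matrix.fromCols P (0 : Matrix (Fin n) (Fin l) J)).submatrix id finSumFinEquiv.symm

/-- The `k`-fold direct sum `a ⊕ ⋯ ⊕ a`. -/
def ampl {A : Type*} [Zero A] {n : ℕ} (k : ℕ) (a : Matrix (Fin n) (Fin n) A) :
    Matrix (Fin (k * n)) (Fin (k * n)) A :=
  Matrix.of fun i j =>
    if (finProdFinEquiv.symm i).1 = (finProdFinEquiv.symm j).1 then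
      a (finProdFinEquiv.symm i).2 (finProdFinEquiv.symm j).2
    else 0

/-- All entries of the matrix belong to `V`. -/
def EntriesIn {A : Type*} [AddCommMonoid A] [Module ℂ A] (V : Submodule ℂ A) {m n : ℕ}
    (a : Matrix (Fin m) (Fin n) A) : Prop :=
  ∀ i j, a i j ∈ V

/-- Noncommutative subset of `V_nc`: closed under direct sums. -/
structure IsNCSet {A : Type*} [AddCommMonoid A] [Module ℂ A] (V : Submodule ℂ A)
    (Ω : NCFamily A) : Prop where
  entries : ∀ n, ∀ a ∈ Ω n, EntriesIn V a
  directSum : ∀ m n, ∀ a ∈ Ω m, ∀ c ∈ Ω n, blk a 0 c ∈ Ω (m + n)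

/-- Noncommutative map between families of matrix sets: respects levels and intertwinings. -/
structure IsNCMap {A B : Type*} [Semiring A] [Algebra ℂ A] [Semiring B] [Algebra ℂ B]
    (D : NCFamily A) (E : NCFamily B)
    (f : ∀ n : ℕ, Matrix (Fin n) (Fin n) A → Matrix (Fin n) (Fin n) B) : Prop where
  mapsTo : ∀ n, ∀ a ∈ D n, f n a ∈ E n
  intertwine : ∀ m n, ∀ a ∈ D m, ∀ c ∈ D n, ∀ S : Matrix (Fin m) (Fin n) ℂ,
    a * scalarMat A S = scalarMat A S * c → f m a * scalarMat B S = scalarMat B S * f n c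

/-- Affine noncommutative kernel on `Ω`: respects intertwinings in both variables. -/
def IsAffineNCKernel {A J K : Type*} [Semiring A] [Algebra ℂ A] [Semiring J] [Algebra ℂ J]
    [Semiring K] [Algebra ℂ K] (Ω : NCFamily A) (G : KernelFamily A J K) : Prop :=
  ∀ m m' n n' : ℕ, ∀ a ∈ Ω m, ∀ a' ∈ Ω m', ∀ c ∈ Ω n, ∀ c' ∈ Ω n',
    ∀ (S : Matrix (Fin m') (Fin m) ℂ) (T : Matrix (Fin n) (Fin n') ℂ),
      scalarMat A S * a = a' * scalarMat A S → c * scalarMat A T = scalarMat A T * c' →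
      ∀ P : Matrix (Fin m) (Fin n) J,
        scalarMat K S * G m n a c P * scalarMat K T =
          G m' n' a' c' (scalarMat J S * P * scalarMat J T)

/-! ### Openness of nc sets and local boundedness of kernels -/

section Regularity

variable {A : Type*} [CStarAlgebra A] [PartialOrder A] [StarOrderedRing A]
  {J : Type*} [CStarAlgebra J] [PartialOrder J] [StarOrderedRing J]
  {K : Type*} [CStarAlgebra K] [PartialOrder K] [StarOrderedRing K]

/-- The operator space norm of a matrix over a C⋆-algebra. -/
def opNorm {m n : ℕ} (a : Matrix (Fin m) (Fin n) A) : ℝ :=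
  ‖CStarMatrix.ofMatrix a‖

/-- Open in the uniformly-open topology: around each point `a ∈ Ω n` there is an nc ball
`{x ∈ V^{kn × kn} : ‖x - (a ⊕ ⋯ ⊕ a)‖ < r, k ∈ ℕ}` inside `Ω`. -/
def IsUniformlyOpen (V : Submodule ℂ A) (Ω : NCFamily A) : Prop :=
  ∀ n, ∀ a ∈ Ω n, ∃ r : ℝ, 0 < r ∧ ∀ (k : ℕ) (x : Matrix (Fin (k * n)) (Fin (k * n)) A),
    EntriesIn V x → opNorm (x - ampl k a) < r → x ∈ Ω (k * n)

/-- Finitely open: the intersection of each level with each finite dimensional subspace `X` of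
`V^{n × n}` is open in `X`. -/
def IsFinitelyOpen (V : Submodule ℂ A) (Ω : NCFamily A) : Prop :=
  ∀ (n : ℕ) (X : Submodule ℂ (Matrix (Fin n) (Fin n) A)), (∀ x ∈ X, EntriesIn V x) →
    FiniteDimensional ℂ X →
      ∃ U : Set (Matrix (Fin n) (Fin n) A), IsOpen U ∧ Ω n ∩ X = U ∩ X

/-- Open in the level topology: each level is open in `V^{n × n}`. -/
def IsLevelOpen (V : Submodule ℂ A) (Ω : NCFamily A) : Prop :=
  ∀ n : ℕ, ∃ U : Set (Matrix (Fin n) (Fin n) A), IsOpen U ∧ Ω n = U ∩ {a | EntriesIn V a}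

/-- The kernel is locally bounded for the uniformly-open topology. -/
def IsLocallyUniformlyBounded (Ω : NCFamily A) (G : KernelFamily A J K) : Prop :=
  ∀ n m, ∀ a ∈ Ω n, ∀ c ∈ Ω m, ∃ r M : ℝ, 0 < r ∧
    ∀ k l, ∀ x ∈ Ω (k * n), ∀ y ∈ Ω (l * m),
      opNorm (x - ampl k a) < r → opNorm (y - ampl l c) < r →
        ∀ P, opNorm (G (k * n) (l * m) x y P) ≤ M * opNorm P

/-- The kernel is locally bounded on slices. -/
def IsLocallyBoundedOnSlices (V : Submodule ℂ A) (Ω : NCFamily A) (G : KernelFamily A J K) :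
    Prop :=
  ∀ n m, ∀ a ∈ Ω n, ∀ c ∈ Ω m, ∀ (b : Matrix (Fin n) (Fin n) A) (d : Matrix (Fin m) (Fin m) A),
    EntriesIn V b → EntriesIn V d → ∃ ε M : ℝ, 0 < ε ∧
      ∀ z w : ℂ, ‖z‖ < ε → ‖w‖ < ε → a + z • b ∈ Ω n → c + w • d ∈ Ω m →
        ∀ P, opNorm (G n m (a + z • b) (c + w • d) P) ≤ M * opNorm P

/-- The alternative "uniformly open and locally uniformly bounded, or finitely open and locally
bounded on slices, or level open and locally bounded on slices". -/
def IsRegular (V : Submodule ℂ A) (Ω : NCFamily A) (G : KernelFamily A J K) : Prop :=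
  (IsUniformlyOpen V Ω ∧ IsLocallyUniformlyBounded Ω G) ∨
  (IsFinitelyOpen V Ω ∧ IsLocallyBoundedOnSlices V Ω G) ∨
  (IsLevelOpen V Ω ∧ IsLocallyBoundedOnSlices V Ω G)

/-- The symmetry `G(a, c)(v)^* = G(c^*, a^*)(v)` for selfadjoint `v`. -/
def IsHermitianKernel (Ω : NCFamily A) (G : KernelFamily A J K) : Prop :=
  ∀ n, ∀ a ∈ Ω n, ∀ c ∈ Ω n, aᴴ ∈ Ω n → cᴴ ∈ Ω n →
    ∀ v : Matrix (Fin n) (Fin n) J, vᴴ = v → (G n n a c v)ᴴ = G n n cᴴ aᴴ v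

/-- The set `{a ∈ Ω : G(a, a^*)(1) > 0}` at level `n`; `> 0` means positive and invertible in the
C⋆-algebra `K^{n × n}`. -/
def positivitySet (Ω : NCFamily A) (G : KernelFamily A J K) : NCFamily A := fun n =>
  {a | a ∈ Ω n ∧ aᴴ ∈ Ω n ∧ IsStrictlyPositive (CStarMatrix.ofMatrix (G n n a aᴴ 1))}

/-- The domain defined by the kernel `G` and the base point `a₀` of level one: at level `k`, the
connected component of `a₀ ⊗ 1_k` in `{a : G(a, a^*)(1) > 0}`. -/
def kernelDomain (Ω : NCFamily A) (G : KernelFamily A J K) (a₀ : A) : NCFamily A := fun k =>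
  connectedComponentIn (positivitySet Ω G k) (Matrix.diagonal fun _ => a₀)

end Regularity

/-! ### The pseudodistances `δ` and `δ̃` of an nc set -/

section Delta

variable {A : Type*} [AddCommGroup A] [Module ℂ A]

/-- `δ_D(a, c)(b) = [sup {t ∈ [0, ∞] : [a sb; 0 c] ∈ D for all finite s ∈ [0, t]}]⁻¹`, with the
conventions `0⁻¹ = ∞`, `∞⁻¹ = 0`. -/
def ncDelta (D : NCFamily A) {n m : ℕ} (a : Matrix (Fin n) (Fin n) A)
    (c : Matrix (Fin m) (Fin m) A) (b : Matrix (Fin n) (Fin m) A) : ℝ≥0∞ :=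
  (sSup {t : ℝ≥0∞ | ∀ s : ℝ≥0, (s : ℝ≥0∞) ≤ t →
    blk a (((s : ℝ) : ℂ) • b) c ∈ D (n + m)})⁻¹

/-- `δ̃_D(a, c) = δ_D(a, c)(a - c)`. -/
def ncDeltaTilde (D : NCFamily A) {n : ℕ} (a c : Matrix (Fin n) (Fin n) A) : ℝ≥0∞ :=
  ncDelta D a c (a - c)

end Delta

/-! ### Difference-differential operators

They are read off from block upper triangular matrices `[a zb; 0 c]` with a scalar `z ≠ 0` for
which this matrix lies in the domain; for maps and kernels that respect intertwinings the result
does not depend on `z`. -/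

section DiffDiff

variable {A : Type*} [AddCommGroup A] [Module ℂ A]

open Classical in
/-- A scalar `z ≠ 0` with `[a zb; 0 c] ∈ Ω` (the value `1` if there is none). -/
def admScalar (Ω : NCFamily A) {n m : ℕ} (a : Matrix (Fin n) (Fin n) A)
    (b : Matrix (Fin n) (Fin m) A) (c : Matrix (Fin m) (Fin m) A) : ℂ :=
  if h : ∃ z : ℂ, z ≠ 0 ∧ blk a (z • b) c ∈ Ω (n + m) then h.choose else 1

/-- `Δf(a, c)(b)`: the `(1,2)` block of `z⁻¹ f([a zb; 0 c])`. -/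
def diffDiff {B : Type*} [AddCommGroup B] [Module ℂ B] (Ω : NCFamily A)
    (f : ∀ n : ℕ, Matrix (Fin n) (Fin n) A → Matrix (Fin n) (Fin n) B) {n m : ℕ}
    (a : Matrix (Fin n) (Fin n) A) (c : Matrix (Fin m) (Fin m) A)
    (b : Matrix (Fin n) (Fin m) A) : Matrix (Fin n) (Fin m) B :=
  (admScalar Ω a b c)⁻¹ •
    (f (n + m) (blk a (admScalar Ω a b c • b) c)).submatrix (Fin.castAdd m) (Fin.natAdd n)

variable {J K : Type*} [AddCommGroup J] [Module ℂ J] [AddCommGroup K] [Module ℂ K]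

/-- `₀ΔG(a; a', c)(b, P)`, given by
`G([a b; 0 a'], c)([P₁; P₂]) = [G(a, c)(P₁) + ₀ΔG(a; a', c)(b, P₂); G(a', c)(P₂)]`. -/
def zeroDiffDiff (Ω : NCFamily A) (G : KernelFamily A J K) {n m k : ℕ}
    (a : Matrix (Fin n) (Fin n) A) (a' : Matrix (Fin m) (Fin m) A)
    (c : Matrix (Fin k) (Fin k) A) (b : Matrix (Fin n) (Fin m) A)
    (P : Matrix (Fin m) (Fin k) J) : Matrix (Fin n) (Fin k) K :=
  (admScalar Ω a b a')⁻¹ •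
    (G (n + m) k (blk a (admScalar Ω a b a' • b) a') c (zeroTop n P)).submatrix
      (Fin.castAdd m) id

/-- `₁ΔG(a, c; c')(P, b)`, given by
`G(a, [c b; 0 c'])([P₁ P₂]) = [G(a, c)(P₁), ₁ΔG(a, c; c')(P₁, b) + G(a, c')(P₂)]`. -/
def oneDiffDiff (Ω : NCFamily A) (G : KernelFamily A J K) {n k l : ℕ}
    (a : Matrix (Fin n) (Fin n) A) (c : Matrix (Fin k) (Fin k) A)
    (c' : Matrix (Fin l) (Fin l) A) (P : Matrix (Fin n) (Fin k) J)
    (b : Matrix (Fin k) (Fin l) A) : Matrix (Fin n) (Fin l) K :=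
  (admScalar Ω c b c')⁻¹ •
    (G n (k + l) a (blk c (admScalar Ω c b c' • b) c') (zeroRight l P)).submatrix
      id (Fin.natAdd k)

/-- `₁Δ₀ΔG(a; a', c; c')(b, P, b')`: the operator `₁Δ` applied to `₀ΔG(a; a', ·)(b, ·)`. -/
def oneZeroDiffDiff (Ω : NCFamily A) (G : KernelFamily A J K) {n m k l : ℕ}
    (a : Matrix (Fin n) (Fin n) A) (a' : Matrix (Fin m) (Fin m) A)
    (c : Matrix (Fin k) (Fin k) A) (c' : Matrix (Fin l) (Fin l) A)
    (b : Matrix (Fin n) (Fin m) A) (P : Matrix (Fin m) (Fin k) J)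
    (b' : Matrix (Fin k) (Fin l) A) : Matrix (Fin n) (Fin l) K :=
  (admScalar Ω c b' c')⁻¹ •
    (zeroDiffDiff Ω G a a' (blk c (admScalar Ω c b' c' • b') c') b (zeroRight l P)).submatrix
      id (Fin.natAdd k)

end DiffDiff

/-! ### The explicit expressions in terms of the kernel -/

section Formula

variable {A : Type*} [CStarAlgebra A] [PartialOrder A] [StarOrderedRing A]
  {J : Type*} [CStarAlgebra J] [PartialOrder J] [StarOrderedRing J]
  {K : Type*} [CStarAlgebra K] [PartialOrder K] [StarOrderedRing K]

/-- `[max {0, sup σ(x)}]^{1/2}` for a selfadjoint element `x` of a C⋆-algebra. -/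
def sqrtSupSpectrum {L : Type*} [CStarAlgebra L] (x : L) : ℝ≥0∞ :=
  ENNReal.ofReal (Real.sqrt (max 0 (sSup (spectrum ℝ x))))

/-- `g^{-1/2} x g^{-1/2}` for a positive invertible element `g` of a C⋆-algebra. -/
def sandwich {L : Type*} [CStarAlgebra L] [PartialOrder L] [StarOrderedRing L] (g x : L) : L :=
  g ^ (-(1 / 2) : ℝ) * x * g ^ (-(1 / 2) : ℝ)

/-- `G(a,a*)(1)^{-1/2} [₀ΔG(a;c,c*)(b,1) G(c,c*)(1)⁻¹ ₁ΔG(c,c*;a*)(1,b*)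
- ₁Δ₀ΔG(a;c,c*;a*)(b,1,b*)] G(a,a*)(1)^{-1/2}`. -/
def infinitesimalElement (Ω : NCFamily A) (G : KernelFamily A J K) {n m : ℕ}
    (a : Matrix (Fin n) (Fin n) A) (c : Matrix (Fin m) (Fin m) A)
    (b : Matrix (Fin n) (Fin m) A) : CStarMatrix (Fin n) (Fin n) K :=
  sandwich (CStarMatrix.ofMatrix (G n n a aᴴ 1))
    (CStarMatrix.ofMatrix
      (zeroDiffDiff Ω G a c cᴴ b 1 * Ring.inverse (G m m c cᴴ 1) * oneDiffDiff Ω G c cᴴ aᴴ 1 bᴴ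
        - oneZeroDiffDiff Ω G a c cᴴ aᴴ b 1 bᴴ))

/-- `G(a,c*)(1) G(c,c*)(1)⁻¹ G(c,a*)(1)`. -/
def crossTerm (G : KernelFamily A J K) {n : ℕ} (a c : Matrix (Fin n) (Fin n) A) :
    Matrix (Fin n) (Fin n) K :=
  G n n a cᴴ 1 * Ring.inverse (G n n c cᴴ 1) * G n n c aᴴ 1

/-- `G(a,a*)(1)^{-1/2} G(a,c*)(1) G(c,c*)(1)⁻¹ G(c,a*)(1) G(a,a*)(1)^{-1/2}`. -/
def pickElement (G : KernelFamily A J K) {n : ℕ} (a c : Matrix (Fin n) (Fin n) A) :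
    CStarMatrix (Fin n) (Fin n) K :=
  sandwich (CStarMatrix.ofMatrix (G n n a aᴴ 1)) (CStarMatrix.ofMatrix (crossTerm G a c))

/-- The kernel is defined at all block triangular matrices over the domain: for `a, c ∈ D` and
every `b` over `V`, the matrix `[a b; 0 c]` and its adjoint belong to `Ω`. -/
def IsTriangularlyDefined (V : Submodule ℂ A) (Ω D : NCFamily A) : Prop :=
  ∀ n m, ∀ a ∈ D n, ∀ c ∈ D m, ∀ b : Matrix (Fin n) (Fin m) A, EntriesIn V b →
    blk a b c ∈ Ω (n + m) ∧ (blk a b c)ᴴ ∈ Ω (n + m)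

/-- The explicit formulas for `δ` and `δ̃` of a domain `D` in terms of the kernel `G`. -/
def HasKernelFormula (V : Submodule ℂ A) (Ω : NCFamily A) (G : KernelFamily A J K)
    (D : NCFamily A) : Prop :=
  (∀ n m, ∀ a ∈ D n, ∀ c ∈ D m, ∀ b : Matrix (Fin n) (Fin m) A, EntriesIn V b →
    ncDelta D a c b = sqrtSupSpectrum (infinitesimalElement Ω G a c b)) ∧
  (∀ n, ∀ a ∈ D n, ∀ c ∈ D n,
    ncDeltaTilde D a c = sqrtSupSpectrum (pickElement G a c - 1))

end Formula

end NCKernel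

end

/-! The statement reduces to deciding when `G(X, X*)(1)` is positive and invertible at `X = [a sb; 0
c]`. The intertwining relations make it a block matrix with diagonal blocks `G(a,a*)(1) + s² ₁Δ₀ΔG`
and `G(c,c*)(1)`, and off-diagonal blocks `s ₀ΔG` and `s ₁ΔG` (`IsAffineNCKernel.apply_blk`). Its
Schur complement, normalized by `G(a,a*)(1)^{-1/2}` on both sides, is `1 - s² x`, with `x` the
selfadjoint element in the formula. For `s ≥ 0` this is positive and invertible exactly when `s ·
sqrt (max 0 (sup σ(x))) < 1`. That condition passes to smaller `s`, so the segment from `a ⊕ c` to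
`X` stays in the positivity set, and `X` lies in the same component as `a ⊕ c`. The component is
closed under direct sums, hence `δ` is this square root (`ncDelta_kernelDomain`).

For `b = a - c` no derivative is needed: `X` is similar to `a ⊕ c` through a scalar unipotent
matrix, so only the values of `G` at `a`, `c` and their adjoints occur, and `x` becomes `Π_G(a,c) -
1` (`IsAffineNCKernel.apply_blk_sub`).

An nc map sends `[a sb; 0 c]` to `[f(a) sΔf(a,c)(b); 0 f(c)]`, so admissible `s` remain admissible
and both pseudodistances contract.

The norm and order inequalities need the formula for `δ̃` only on the side of `G`. For `H` the lower
bound `sqrtSupSpectrum_pickElement_le` suffices, and it looks only at triangular matrices already in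
the domain, so `H` need not be triangularly defined. Since `Π ≥ 0`, `‖Π‖ ≤ 1 + r` means `Π - 1 ≤ r`,
which is a bound on the same spectral quantity. -/

set_option linter.unusedSectionVars false

namespace NCKernel

/-! ### Block matrices indexed by `Fin (n + m)` -/

section Blocks

variable {R : Type*} {n m k l p q : ℕ}

/-- The block matrix `[a b; c d]`. -/
def blkMat (a : Matrix (Fin n) (Fin k) R) (b : Matrix (Fin n) (Fin l) R)
    (c : Matrix (Fin m) (Fin k) R) (d : Matrix (Fin m) (Fin l) R) :
    Matrix (Fin (n + m)) (Fin (k + l)) R :=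
  (Matrix.fromBlocks a b c d).submatrix finSumFinEquiv.symm finSumFinEquiv.symm

/-- The block column `[a; b]`. -/
def blkCol (a : Matrix (Fin n) (Fin k) R) (b : Matrix (Fin m) (Fin k) R) :
    Matrix (Fin (n + m)) (Fin k) R :=
  (Matrix.fromRows a b).submatrix finSumFinEquiv.symm id

/-- The block row `[a b]`. -/
def blkRow (a : Matrix (Fin n) (Fin k) R) (b : Matrix (Fin n) (Fin l) R) :
    Matrix (Fin n) (Fin (k + l)) R :=
  (Matrix.fromCols a b).submatrix id finSumFinEquiv.symm

theorem blk_eq_blkMat [Zero R] (a : Matrix (Fin n) (Fin n) R) (b : Matrix (Fin n) (Fin m) R)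
    (c : Matrix (Fin m) (Fin m) R) : blk a b c = blkMat a b 0 c := rfl

theorem zeroTop_eq_blkCol [Zero R] (P : Matrix (Fin m) (Fin k) R) :
    zeroTop n P = blkCol 0 P := rfl

theorem zeroRight_eq_blkRow [Zero R] (P : Matrix (Fin n) (Fin k) R) :
    zeroRight l P = blkRow P 0 := rfl

theorem blkMat_inj {a a' : Matrix (Fin n) (Fin k) R} {b b' : Matrix (Fin n) (Fin l) R}
    {c c' : Matrix (Fin m) (Fin k) R} {d d' : Matrix (Fin m) (Fin l) R} :
    blkMat a b c d = blkMat a' b' c' d' ↔ a = a' ∧ b = b' ∧ c = c' ∧ d = d' := by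
  refine ⟨fun h => ?_, by rintro ⟨rfl, rfl, rfl, rfl⟩; rfl⟩
  have h' := congrArg (fun M => M.submatrix finSumFinEquiv finSumFinEquiv) h
  simpa [blkMat, Matrix.submatrix_submatrix, Matrix.fromBlocks_inj] using h'

theorem blkCol_inj {a a' : Matrix (Fin n) (Fin k) R} {b b' : Matrix (Fin m) (Fin k) R} :
    blkCol a b = blkCol a' b' ↔ a = a' ∧ b = b' := by
  refine ⟨fun h => ?_, by rintro ⟨rfl, rfl⟩; rfl⟩
  have h' := congrArg (fun M => M.submatrix finSumFinEquiv id) h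
  simpa [blkCol, Matrix.submatrix_submatrix, Matrix.fromRows_inj.eq_iff] using h'

theorem blkRow_inj {a a' : Matrix (Fin n) (Fin k) R} {b b' : Matrix (Fin n) (Fin l) R} :
    blkRow a b = blkRow a' b' ↔ a = a' ∧ b = b' := by
  refine ⟨fun h => ?_, by rintro ⟨rfl, rfl⟩; rfl⟩
  have h' := congrArg (fun M => M.submatrix id finSumFinEquiv) h
  simpa [blkRow, Matrix.submatrix_submatrix, Matrix.fromCols_inj.eq_iff] using h'

theorem exists_eq_blkMat (M : Matrix (Fin (n + m)) (Fin (k + l)) R) :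
    ∃ a b c d, M = blkMat a b c d :=
  ⟨_, _, _, _, by
    rw [blkMat, Matrix.fromBlocks_toBlocks (M.submatrix finSumFinEquiv finSumFinEquiv)]
    simp [Matrix.submatrix_submatrix]⟩

theorem exists_eq_blkCol (M : Matrix (Fin (n + m)) (Fin k) R) : ∃ a b, M = blkCol a b :=
  ⟨_, _, by
    rw [blkCol, Matrix.fromRows_toRows (M.submatrix finSumFinEquiv id)]
    simp [Matrix.submatrix_submatrix]⟩

theorem exists_eq_blkRow (M : Matrix (Fin n) (Fin (k + l)) R) : ∃ a b, M = blkRow a b :=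
  ⟨_, _, by
    rw [blkRow, Matrix.fromCols_toCols (M.submatrix id finSumFinEquiv)]
    simp [Matrix.submatrix_submatrix]⟩

@[simp] theorem blkMat_submatrix_castAdd_natAdd (a : Matrix (Fin n) (Fin k) R)
    (b : Matrix (Fin n) (Fin l) R) (c : Matrix (Fin m) (Fin k) R) (d : Matrix (Fin m) (Fin l) R) :
    (blkMat a b c d).submatrix (Fin.castAdd m) (Fin.natAdd k) = b := by
  ext i j; simp [blkMat]

@[simp] theorem blkCol_submatrix_castAdd (a : Matrix (Fin n) (Fin k) R)
    (b : Matrix (Fin m) (Fin k) R) : (blkCol a b).submatrix (Fin.castAdd m) id = a := by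
  ext i j; simp [blkCol]

@[simp] theorem blkRow_submatrix_natAdd (a : Matrix (Fin n) (Fin k) R)
    (b : Matrix (Fin n) (Fin l) R) : (blkRow a b).submatrix id (Fin.natAdd k) = b := by
  ext i j; simp [blkRow]

theorem blkMat_add [Add R] (a a' : Matrix (Fin n) (Fin k) R) (b b' : Matrix (Fin n) (Fin l) R)
    (c c' : Matrix (Fin m) (Fin k) R) (d d' : Matrix (Fin m) (Fin l) R) :
    blkMat a b c d + blkMat a' b' c' d' = blkMat (a + a') (b + b') (c + c') (d + d') := by
  rw [blkMat, blkMat, blkMat, ← Matrix.fromBlocks_add, Matrix.submatrix_add]; rfl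

theorem smul_blkMat {S : Type*} [SMul S R] (s : S) (a : Matrix (Fin n) (Fin k) R)
    (b : Matrix (Fin n) (Fin l) R) (c : Matrix (Fin m) (Fin k) R) (d : Matrix (Fin m) (Fin l) R) :
    s • blkMat a b c d = blkMat (s • a) (s • b) (s • c) (s • d) := by
  rw [blkMat, blkMat, ← Matrix.fromBlocks_smul, Matrix.submatrix_smul]; rfl

theorem smul_blkCol {S : Type*} [SMul S R] (s : S) (a : Matrix (Fin n) (Fin k) R)
    (b : Matrix (Fin m) (Fin k) R) : s • blkCol a b = blkCol (s • a) (s • b) := by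
  ext i j
  obtain ⟨i, rfl⟩ := finSumFinEquiv.surjective i
  rcases i with i | i <;> simp [blkCol]

theorem smul_blkRow {S : Type*} [SMul S R] (s : S) (a : Matrix (Fin n) (Fin k) R)
    (b : Matrix (Fin n) (Fin l) R) : s • blkRow a b = blkRow (s • a) (s • b) := by
  ext i j
  obtain ⟨j, rfl⟩ := finSumFinEquiv.surjective j
  rcases j with j | j <;> simp [blkRow]

theorem conjTranspose_blkMat [Star R] (a : Matrix (Fin n) (Fin k) R)
    (b : Matrix (Fin n) (Fin l) R) (c : Matrix (Fin m) (Fin k) R) (d : Matrix (Fin m) (Fin l) R) :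
    (blkMat a b c d)ᴴ = blkMat aᴴ cᴴ bᴴ dᴴ := by
  rw [blkMat, Matrix.conjTranspose_submatrix, Matrix.fromBlocks_conjTranspose]; rfl

theorem conjTranspose_blkCol [Star R] (a : Matrix (Fin n) (Fin k) R)
    (b : Matrix (Fin m) (Fin k) R) : (blkCol a b)ᴴ = blkRow aᴴ bᴴ := by
  rw [blkCol, Matrix.conjTranspose_submatrix, Matrix.conjTranspose_fromRows_eq_fromCols_conjTranspose]
  rfl

theorem conjTranspose_blkRow [Star R] (a : Matrix (Fin n) (Fin k) R)
    (b : Matrix (Fin n) (Fin l) R) : (blkRow a b)ᴴ = blkCol aᴴ bᴴ := by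
  rw [blkRow, Matrix.conjTranspose_submatrix, Matrix.conjTranspose_fromCols_eq_fromRows_conjTranspose]
  rfl

theorem blkMat_one [Zero R] [One R] :
    blkMat (1 : Matrix (Fin n) (Fin n) R) 0 0 (1 : Matrix (Fin m) (Fin m) R) = 1 := by
  rw [blkMat, Matrix.fromBlocks_one, Matrix.submatrix_one_equiv]

theorem map_blkMat {S : Type*} (f : R → S) (a : Matrix (Fin n) (Fin k) R)
    (b : Matrix (Fin n) (Fin l) R) (c : Matrix (Fin m) (Fin k) R) (d : Matrix (Fin m) (Fin l) R) :
    (blkMat a b c d).map f = blkMat (a.map f) (b.map f) (c.map f) (d.map f) := by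
  rw [blkMat, blkMat, ← Matrix.fromBlocks_map]; rfl

theorem map_blkCol {S : Type*} (f : R → S) (a : Matrix (Fin n) (Fin k) R)
    (b : Matrix (Fin m) (Fin k) R) : (blkCol a b).map f = blkCol (a.map f) (b.map f) := by
  ext i j
  obtain ⟨i, rfl⟩ := finSumFinEquiv.surjective i
  rcases i with i | i <;> simp [blkCol]

theorem map_blkRow {S : Type*} (f : R → S) (a : Matrix (Fin n) (Fin k) R)
    (b : Matrix (Fin n) (Fin l) R) : (blkRow a b).map f = blkRow (a.map f) (b.map f) := by
  ext i j
  obtain ⟨j, rfl⟩ := finSumFinEquiv.surjective j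
  rcases j with j | j <;> simp [blkRow]

theorem blkCol_zero_blkRow [Zero R] (a : Matrix (Fin m) (Fin k) R) (b : Matrix (Fin m) (Fin l) R) :
    (blkCol 0 (blkRow a b) : Matrix (Fin (n + m)) (Fin (k + l)) R) = blkMat 0 0 a b := by
  ext i j
  obtain ⟨i, rfl⟩ := finSumFinEquiv.surjective i
  obtain ⟨j, rfl⟩ := finSumFinEquiv.surjective j
  rcases i with i | i <;> rcases j with j | j <;> simp [blkMat, blkCol, blkRow]

section Mul

variable [Semiring R]

theorem blkMat_mul_blkMat (a : Matrix (Fin n) (Fin k) R) (b : Matrix (Fin n) (Fin l) R)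
    (c : Matrix (Fin m) (Fin k) R) (d : Matrix (Fin m) (Fin l) R)
    (a' : Matrix (Fin k) (Fin p) R) (b' : Matrix (Fin k) (Fin q) R)
    (c' : Matrix (Fin l) (Fin p) R) (d' : Matrix (Fin l) (Fin q) R) :
    blkMat a b c d * blkMat a' b' c' d' =
      blkMat (a * a' + b * c') (a * b' + b * d') (c * a' + d * c') (c * b' + d * d') := by
  rw [blkMat, blkMat, blkMat, Matrix.submatrix_mul_equiv, Matrix.fromBlocks_multiply]

theorem blkMat_mul_blkCol (a : Matrix (Fin n) (Fin k) R) (b : Matrix (Fin n) (Fin l) R)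
    (c : Matrix (Fin m) (Fin k) R) (d : Matrix (Fin m) (Fin l) R)
    (a' : Matrix (Fin k) (Fin p) R) (c' : Matrix (Fin l) (Fin p) R) :
    blkMat a b c d * blkCol a' c' = blkCol (a * a' + b * c') (c * a' + d * c') := by
  rw [blkMat, blkCol, blkCol, Matrix.submatrix_mul_equiv, Matrix.fromBlocks_mul_fromRows]

theorem blkRow_mul_blkMat (a : Matrix (Fin n) (Fin k) R) (b : Matrix (Fin n) (Fin l) R)
    (a' : Matrix (Fin k) (Fin p) R) (b' : Matrix (Fin k) (Fin q) R)
    (c' : Matrix (Fin l) (Fin p) R) (d' : Matrix (Fin l) (Fin q) R) :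
    blkRow a b * blkMat a' b' c' d' = blkRow (a * a' + b * c') (a * b' + b * d') := by
  rw [blkMat, blkRow, blkRow, Matrix.submatrix_mul_equiv, Matrix.fromCols_mul_fromBlocks]

theorem blkRow_mul_blkCol (a : Matrix (Fin n) (Fin k) R) (b : Matrix (Fin n) (Fin l) R)
    (a' : Matrix (Fin k) (Fin p) R) (b' : Matrix (Fin l) (Fin p) R) :
    blkRow a b * blkCol a' b' = a * a' + b * b' := by
  rw [blkCol, blkRow, Matrix.submatrix_mul_equiv, Matrix.fromCols_mul_fromRows]; rfl

theorem blkCol_mul_blkRow (a : Matrix (Fin n) (Fin k) R) (b : Matrix (Fin m) (Fin k) R)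
    (a' : Matrix (Fin k) (Fin p) R) (b' : Matrix (Fin k) (Fin q) R) :
    blkCol a b * blkRow a' b' = blkMat (a * a') (a * b') (b * a') (b * b') := by
  rw [blkCol, blkRow, blkMat, ← Matrix.fromRows_mul_fromCols]; rfl

theorem blkCol_mul (a : Matrix (Fin n) (Fin k) R) (b : Matrix (Fin m) (Fin k) R)
    (x : Matrix (Fin k) (Fin p) R) : blkCol a b * x = blkCol (a * x) (b * x) := by
  rw [blkCol, blkCol, ← Matrix.fromRows_mul]; rfl

theorem mul_blkRow (x : Matrix (Fin p) (Fin n) R) (a : Matrix (Fin n) (Fin k) R)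
    (b : Matrix (Fin n) (Fin l) R) : x * blkRow a b = blkRow (x * a) (x * b) := by
  rw [blkRow, blkRow, ← Matrix.mul_fromCols]; rfl

end Mul

section Scalar

variable [Semiring R] [Algebra ℂ R]

@[simp] theorem scalarMat_blkMat (a : Matrix (Fin n) (Fin k) ℂ) (b : Matrix (Fin n) (Fin l) ℂ)
    (c : Matrix (Fin m) (Fin k) ℂ) (d : Matrix (Fin m) (Fin l) ℂ) :
    scalarMat R (blkMat a b c d) =
      blkMat (scalarMat R a) (scalarMat R b) (scalarMat R c) (scalarMat R d) :=
  map_blkMat _ _ _ _ _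

@[simp] theorem scalarMat_blkCol (a : Matrix (Fin n) (Fin k) ℂ) (b : Matrix (Fin m) (Fin k) ℂ) :
    scalarMat R (blkCol a b) = blkCol (scalarMat R a) (scalarMat R b) :=
  map_blkCol _ _ _

@[simp] theorem scalarMat_blkRow (a : Matrix (Fin n) (Fin k) ℂ) (b : Matrix (Fin n) (Fin l) ℂ) :
    scalarMat R (blkRow a b) = blkRow (scalarMat R a) (scalarMat R b) :=
  map_blkRow _ _ _

@[simp] theorem scalarMat_zero : scalarMat R (0 : Matrix (Fin n) (Fin m) ℂ) = 0 := by
  ext; simp [scalarMat]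

@[simp] theorem scalarMat_one : scalarMat R (1 : Matrix (Fin n) (Fin n) ℂ) = 1 := by
  simp [scalarMat]

@[simp] theorem scalarMat_smul (z : ℂ) (a : Matrix (Fin n) (Fin m) ℂ) :
    scalarMat R (z • a) = z • scalarMat R a := by
  ext; simp [scalarMat, Algebra.smul_def]

end Scalar

end Blocks

/-! ### Positivity of matrices over a C⋆-algebra -/

theorem exists_eq_star_mul_self_of_nonneg {L : Type*} [CStarAlgebra L] [PartialOrder L]
    [StarOrderedRing L] {x : L} (hx : 0 ≤ x) : ∃ y, x = star y * y :=
  CStarAlgebra.nonneg_iff_eq_star_mul_self.1 hx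

section Positivity

variable {K : Type*} [CStarAlgebra K] [PartialOrder K] [StarOrderedRing K] {n m p : ℕ}

/-- A matrix that is positive and invertible in the C⋆-algebra of matrices over `K`. -/
abbrev MatPos (x : Matrix (Fin n) (Fin n) K) : Prop :=
  IsStrictlyPositive (CStarMatrix.ofMatrix x)

theorem ofMatrix_add (x y : Matrix (Fin n) (Fin n) K) :
    CStarMatrix.ofMatrix (x + y) = CStarMatrix.ofMatrix x + CStarMatrix.ofMatrix y := rfl

theorem ofMatrix_sub (x y : Matrix (Fin n) (Fin n) K) :
    CStarMatrix.ofMatrix (x - y) = CStarMatrix.ofMatrix x - CStarMatrix.ofMatrix y := rfl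

theorem isUnit_ofMatrix_iff {x : Matrix (Fin n) (Fin n) K} :
    IsUnit (CStarMatrix.ofMatrix x) ↔ IsUnit x :=
  MulEquiv.isUnit_map (CStarMatrix.ofMatrixRingEquiv (n := Fin n) (A := K))

theorem MatPos.isUnit {x : Matrix (Fin n) (Fin n) K} (hx : MatPos x) : IsUnit x :=
  isUnit_ofMatrix_iff.1 (IsStrictlyPositive.isUnit hx)

theorem MatPos.conjTranspose_eq {x : Matrix (Fin n) (Fin n) K} (hx : MatPos x) : xᴴ = x :=
  show star (CStarMatrix.ofMatrix x) = CStarMatrix.ofMatrix x from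
    (IsStrictlyPositive.isSelfAdjoint hx).star_eq

theorem MatPos.conjTranspose_ringInverse {c : Matrix (Fin n) (Fin n) K} (hc : MatPos c) :
    (Ring.inverse c)ᴴ = Ring.inverse c := by
  have h1 := Ring.mul_inverse_cancel _ (MatPos.isUnit hc)
  have h2 : (Ring.inverse c)ᴴ * c = 1 := by
    have := congrArg Matrix.conjTranspose h1
    rwa [Matrix.conjTranspose_mul, MatPos.conjTranspose_eq hc, Matrix.conjTranspose_one] at this
  calc (Ring.inverse c)ᴴ = (Ring.inverse c)ᴴ * (c * Ring.inverse c) := by rw [h1, mul_one]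
    _ = Ring.inverse c := by rw [← mul_assoc, h2, one_mul]

/-- Since `z` may be rectangular, each of its rows is placed in the top row of a square matrix `y
i`; then `zᴴ * z` is the sum of the squares `(y i)ᴴ * y i`. Size `0` has no top row and is treated
apart. -/
theorem ofMatrix_conjTranspose_mul_self_nonneg (z : Matrix (Fin p) (Fin n) K) :
    0 ≤ CStarMatrix.ofMatrix (zᴴ * z) := by
  rcases n with _ | n
  · exact le_of_eq (Subsingleton.elim (α := Matrix (Fin 0) (Fin 0) K) _ _)
  let y : Fin p → Matrix (Fin (n + 1)) (Fin (n + 1)) K := fun i =>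
    Matrix.of fun k l => if k = 0 then z i l else 0
  have h : CStarMatrix.ofMatrix (zᴴ * z) =
      ∑ i, star (CStarMatrix.ofMatrix (y i)) * CStarMatrix.ofMatrix (y i) := by
    have h1 : zᴴ * z = ∑ i, (y i)ᴴ * y i := by
      ext k l
      simp [Matrix.mul_apply, Matrix.sum_apply, y]
    rw [h1]
    exact map_sum (CStarMatrix.ofMatrixRingEquiv (n := Fin (n + 1)) (A := K)) _ _
  rw [h]
  exact Finset.sum_nonneg fun i _ => star_mul_self_nonneg _

theorem ofMatrix_conj_nonneg {x : Matrix (Fin n) (Fin n) K}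
    (hx : 0 ≤ CStarMatrix.ofMatrix x) (P : Matrix (Fin n) (Fin p) K) :
    0 ≤ CStarMatrix.ofMatrix (Pᴴ * x * P) := by
  obtain ⟨y, hy⟩ := exists_eq_star_mul_self_of_nonneg hx
  obtain ⟨y, rfl⟩ := CStarMatrix.ofMatrix.surjective y
  have h : x = yᴴ * y := hy
  have := ofMatrix_conjTranspose_mul_self_nonneg (y * P)
  rwa [Matrix.conjTranspose_mul, Matrix.mul_assoc, ← Matrix.mul_assoc yᴴ, ← h,
    ← Matrix.mul_assoc] at this

theorem matPos_blkMat_diag_iff {x : Matrix (Fin n) (Fin n) K} {y : Matrix (Fin m) (Fin m) K} :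
    MatPos (blkMat x 0 0 y) ↔ MatPos x ∧ MatPos y := by
  constructor
  · intro h
    have h0 : 0 ≤ CStarMatrix.ofMatrix (blkMat x 0 0 y) := h.nonneg
    -- The diagonal blocks of the inverse invert `x` and `y`; positivity follows by compressing to
    -- each coordinate block.
    obtain ⟨N, hN1, hN2⟩ := isUnit_iff_exists.1 (MatPos.isUnit h)
    obtain ⟨a, b, c, d, rfl⟩ := exists_eq_blkMat N
    rw [blkMat_mul_blkMat, ← blkMat_one, blkMat_inj] at hN1 hN2
    simp only [Matrix.zero_mul, add_zero, zero_add, Matrix.mul_zero] at hN1 hN2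
    refine ⟨⟨?_, isUnit_ofMatrix_iff.2 (isUnit_iff_exists.2 ⟨a, hN1.1, hN2.1⟩)⟩,
      ⟨?_, isUnit_ofMatrix_iff.2 (isUnit_iff_exists.2 ⟨d, hN1.2.2.2, hN2.2.2.2⟩)⟩⟩
    · have := ofMatrix_conj_nonneg h0 (blkCol (1 : Matrix (Fin n) (Fin n) K) 0)
      simpa [conjTranspose_blkCol, blkRow_mul_blkMat, blkRow_mul_blkCol] using this
    · have := ofMatrix_conj_nonneg h0 (blkCol 0 (1 : Matrix (Fin m) (Fin m) K))
      simpa [conjTranspose_blkCol, blkRow_mul_blkMat, blkRow_mul_blkCol] using this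
  · rintro ⟨hx, hy⟩
    obtain ⟨x', hx1, hx2⟩ := isUnit_iff_exists.1 (MatPos.isUnit hx)
    obtain ⟨y', hy1, hy2⟩ := isUnit_iff_exists.1 (MatPos.isUnit hy)
    refine ⟨?_, isUnit_ofMatrix_iff.2 (isUnit_iff_exists.2 ⟨blkMat x' 0 0 y', ?_, ?_⟩)⟩
    · have h1 := ofMatrix_conj_nonneg hx.nonneg (blkRow (1 : Matrix (Fin n) (Fin n) K)
        (0 : Matrix (Fin n) (Fin m) K))
      have h2 := ofMatrix_conj_nonneg hy.nonneg (blkRow (0 : Matrix (Fin m) (Fin n) K)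
        (1 : Matrix (Fin m) (Fin m) K))
      have h3 := add_nonneg h1 h2
      rw [← ofMatrix_add] at h3
      simpa [conjTranspose_blkRow, blkCol_mul _ _ x, blkCol_mul _ _ y, blkCol_mul_blkRow,
        blkMat_add] using h3
    · simp [blkMat_mul_blkMat, hx1, hy1, blkMat_one]
    · simp [blkMat_mul_blkMat, hx2, hy2, blkMat_one]

theorem matPos_conj_iff {u : Matrix (Fin n) (Fin n) K} (hu : IsUnit u)
    (x : Matrix (Fin n) (Fin n) K) : MatPos (u * x * uᴴ) ↔ MatPos x :=
  IsUnit.isStrictlyPositive_star_right_conjugate_iff (isUnit_ofMatrix_iff.2 hu)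

/-- The Schur complement criterion. -/
theorem matPos_blkMat_iff {a : Matrix (Fin n) (Fin n) K} {b : Matrix (Fin n) (Fin m) K}
    {b' : Matrix (Fin m) (Fin n) K} {c : Matrix (Fin m) (Fin m) K} (hc : MatPos c)
    (hb : bᴴ = b') :
    MatPos (blkMat a b b' c) ↔ MatPos (a - b * Ring.inverse c * b') := by
  have hcu := MatPos.isUnit hc
  have h1 : Ring.inverse c * c = 1 := Ring.inverse_mul_cancel _ hcu
  have h2 : c * Ring.inverse c = 1 := Ring.mul_inverse_cancel _ hcu
  have hst := MatPos.conjTranspose_ringInverse hc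
  -- Block elimination: congruence by this unipotent matrix clears the off-diagonal blocks.
  set u : Matrix (Fin (n + m)) (Fin (n + m)) K := blkMat 1 (b * Ring.inverse c) 0 1
  have hu : IsUnit u := by
    refine isUnit_iff_exists.2 ⟨blkMat 1 (-(b * Ring.inverse c)) 0 1, ?_, ?_⟩ <;>
      simp [u, blkMat_mul_blkMat, blkMat_one]
  have hM : blkMat a b b' c = u * blkMat (a - b * Ring.inverse c * b') 0 0 c * uᴴ := by
    subst hb
    simp [u, conjTranspose_blkMat, blkMat_mul_blkMat, hst, Matrix.mul_assoc, h1,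
      ← Matrix.mul_assoc c, h2]
  rw [hM, matPos_conj_iff hu, matPos_blkMat_diag_iff, and_iff_left hc]

end Positivity

/-! ### Normalization by `g^{-1/2}` on both sides -/

section Sandwich

variable {L : Type*} [CStarAlgebra L] [PartialOrder L] [StarOrderedRing L] {g : L}

theorem isSelfAdjoint_sandwich {x : L} (hx : IsSelfAdjoint x) : IsSelfAdjoint (sandwich g x) := by
  have hr : IsSelfAdjoint (g ^ (-(1 / 2) : ℝ)) := CFC.rpow_nonneg.isSelfAdjoint
  exact hx.conjugate_self hr

theorem sandwich_self (hg : IsStrictlyPositive g) : sandwich g g = 1 :=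
  CFC.conjugate_rpow_neg_one_half g

theorem sandwich_sub (x y : L) : sandwich g (x - y) = sandwich g x - sandwich g y := by
  simp [sandwich, mul_sub, sub_mul]

theorem sandwich_smul (r : ℝ) (x : L) : sandwich g (r • x) = r • sandwich g x := by
  simp [sandwich]

theorem isStrictlyPositive_sandwich_iff (hg : IsStrictlyPositive g) {x : L} :
    IsStrictlyPositive (sandwich g x) ↔ IsStrictlyPositive x :=
  IsUnit.isStrictlyPositive_iff_conjugate_of_isSelfAdjoint _ _ (hg.rpow g _).isUnit
    CFC.rpow_nonneg.isSelfAdjoint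

theorem sandwich_nonneg_iff (hg : IsStrictlyPositive g) {x : L} :
    0 ≤ sandwich g x ↔ 0 ≤ x := by
  have hr : IsSelfAdjoint (g ^ (-(1 / 2) : ℝ)) := CFC.rpow_nonneg.isSelfAdjoint
  have := (hg.rpow g (-(1 / 2) : ℝ)).isUnit.star_right_conjugate_nonneg_iff (x := x)
  rwa [hr.star_eq] at this

theorem isStrictlyPositive_sub_smul_iff (hg : IsStrictlyPositive g) (x : L) (r : ℝ) :
    IsStrictlyPositive (g - r • x) ↔ IsStrictlyPositive (1 - r • sandwich g x) := by
  rw [← isStrictlyPositive_sandwich_iff hg, sandwich_sub, sandwich_smul, sandwich_self hg]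

theorem le_smul_iff_sandwich_le (hg : IsStrictlyPositive g) (x : L) (r : ℝ) :
    x ≤ r • g ↔ sandwich g x ≤ r • (1 : L) := by
  rw [← sub_nonneg, ← sandwich_nonneg_iff hg, sandwich_sub, sandwich_smul, sandwich_self hg,
    sub_nonneg]

end Sandwich

/-! ### The pseudodistance `δ` and the spectrum -/

section Spectral

variable {L : Type*} [CStarAlgebra L] [PartialOrder L] [StarOrderedRing L] {x : L}

open scoped Pointwise in
theorem isStrictlyPositive_one_sub_smul_iff (hx : IsSelfAdjoint x) (k : ℝ) :
    IsStrictlyPositive (1 - k • x) ↔ ∀ l ∈ spectrum ℝ x, k * l < 1 := by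
  have hsa : IsSelfAdjoint (1 - k • x) :=
    (IsSelfAdjoint.one L).sub ((IsSelfAdjoint.all k).smul hx)
  -- The scaling rule for spectra used below needs an invertible scalar.
  rcases eq_or_ne k 0 with rfl | hk
  · simp
  rw [StarOrderedRing.isStrictlyPositive_iff_spectrum_pos (R := ℝ) _ hsa]
  have h1 : spectrum ℝ (1 - k • x) = {1} - k • spectrum ℝ x := by
    have := spectrum.unit_smul_eq_smul x (Units.mk0 k hk)
    rw [Units.smul_def, Units.val_mk0, Units.smul_def, Units.val_mk0] at this
    rw [← this, spectrum.singleton_sub_eq, map_one]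
  rw [h1]
  simp [Set.mem_smul_set]

/-- The spectrum is compact, so its supremum is attained and the strict inequality survives. An
empty spectrum causes no harm, because `sSup ∅ = 0` in `ℝ`. -/
theorem forall_spectrum_mul_lt_one_iff {L : Type*} [CStarAlgebra L] (x : L) {k : ℝ} (hk : 0 ≤ k) :
    (∀ l ∈ spectrum ℝ x, k * l < 1) ↔ k * max 0 (sSup (spectrum ℝ x)) < 1 := by
  have hcpt : IsCompact (spectrum ℝ x) := spectrum.isCompact x
  rcases (spectrum ℝ x).eq_empty_or_nonempty with he | hne
  · simp [he]
  · constructor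
    · intro h
      rcases max_choice 0 (sSup (spectrum ℝ x)) with h0 | h0 <;> rw [h0]
      · simp
      · exact h _ (hcpt.sSup_mem hne)
    · intro h l hl
      refine lt_of_le_of_lt (mul_le_mul_of_nonneg_left ?_ hk) h
      exact (le_csSup hcpt.bddAbove hl).trans (le_max_right _ _)

theorem le_smul_one_iff_sqrtSupSpectrum_le (hx : IsSelfAdjoint x) {r : ℝ} (hr : 0 ≤ r) :
    x ≤ r • (1 : L) ↔ sqrtSupSpectrum x ≤ ENNReal.ofReal (Real.sqrt r) := by
  have hcpt : IsCompact (spectrum ℝ x) := spectrum.isCompact x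
  rw [← Algebra.algebraMap_eq_smul_one, le_algebraMap_iff_spectrum_le, sqrtSupSpectrum,
    ENNReal.ofReal_le_ofReal_iff (Real.sqrt_nonneg _), Real.sqrt_le_sqrt_iff hr]
  rcases (spectrum ℝ x).eq_empty_or_nonempty with he | hne
  · simp [he, hr]
  · rw [max_le_iff, csSup_le_iff hcpt.bddAbove hne]
    tauto

end Spectral

section Delta

variable {A : Type*} [AddCommGroup A] [Module ℂ A] {L : Type*} [CStarAlgebra L] [PartialOrder L]
  [StarOrderedRing L] {x : L} {D : NCFamily A} {n m : ℕ} {a : Matrix (Fin n) (Fin n) A}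
  {c : Matrix (Fin m) (Fin m) A} {b : Matrix (Fin n) (Fin m) A}

theorem isStrictlyPositive_one_sub_sq_smul_iff (hx : IsSelfAdjoint x) (s : ℝ≥0) :
    IsStrictlyPositive (1 - ((s : ℝ) ^ 2) • x) ↔ s * sqrtSupSpectrum x < 1 := by
  rw [isStrictlyPositive_one_sub_smul_iff hx, forall_spectrum_mul_lt_one_iff x (sq_nonneg _),
    sqrtSupSpectrum, ← ENNReal.ofReal_coe_nnreal, ← ENNReal.ofReal_mul s.coe_nonneg, ← ENNReal.ofReal_one,
    ENNReal.ofReal_lt_ofReal_iff one_pos]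
  set l := max 0 (sSup (spectrum ℝ x))
  have hl : (0 : ℝ) ≤ l := le_max_left _ _
  have h : ((s : ℝ) * Real.sqrt l) ^ 2 = (s : ℝ) ^ 2 * l := by rw [mul_pow, Real.sq_sqrt hl]
  rw [← h]
  exact sq_lt_one_iff₀ (mul_nonneg s.2 (Real.sqrt_nonneg l))

/-- If `t` is admissible, every `s < t` satisfies `s * sqrtSupSpectrum x < 1`, so `t` is at most the
inverse. This half is kept separate because it is all that is available for a kernel that need not
be triangularly defined. -/
theorem sqrtSupSpectrum_le_ncDelta (hx : IsSelfAdjoint x)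
    (h : ∀ s : ℝ≥0, blk a (((s : ℝ) : ℂ) • b) c ∈ D (n + m) →
      IsStrictlyPositive (1 - ((s : ℝ) ^ 2) • x)) :
    sqrtSupSpectrum x ≤ ncDelta D a c b := by
  refine ENNReal.le_inv_iff_le_inv.1 (sSup_le fun t ht => ?_)
  refine ENNReal.le_of_forall_nnreal_lt fun s hs => ?_
  have := (isStrictlyPositive_one_sub_sq_smul_iff hx s).1 (h s (ht s hs.le))
  exact ENNReal.le_inv_iff_mul_le.2 this.le

theorem ncDelta_le_sqrtSupSpectrum (hx : IsSelfAdjoint x)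
    (h : ∀ s : ℝ≥0, IsStrictlyPositive (1 - ((s : ℝ) ^ 2) • x) →
      blk a (((s : ℝ) : ℂ) • b) c ∈ D (n + m)) :
    ncDelta D a c b ≤ sqrtSupSpectrum x := by
  refine ENNReal.inv_le_iff_inv_le.1 (ENNReal.le_of_forall_nnreal_lt fun t ht => le_sSup ?_)
  refine fun s hs => h s ((isStrictlyPositive_one_sub_sq_smul_iff hx s).2 ?_)
  exact ENNReal.mul_lt_of_lt_div (by simpa using hs.trans_lt ht)

theorem ncDelta_eq_sqrtSupSpectrum (hx : IsSelfAdjoint x)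
    (h : ∀ s : ℝ≥0, blk a (((s : ℝ) : ℂ) • b) c ∈ D (n + m) ↔
      IsStrictlyPositive (1 - ((s : ℝ) ^ 2) • x)) :
    ncDelta D a c b = sqrtSupSpectrum x :=
  le_antisymm (ncDelta_le_sqrtSupSpectrum hx fun s => (h s).2)
    (sqrtSupSpectrum_le_ncDelta hx fun s => (h s).1)

end Delta

/-! ### Kernels at block triangular points -/

section KernelBlocks

variable {A J K : Type*} [CStarAlgebra A] [CStarAlgebra J] [CStarAlgebra K]
  {O : NCFamily A} {G : KernelFamily A J K} {n m k l : ℕ}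

/-- Each block is isolated by intertwining with a coordinate projection on the left and a coordinate
inclusion on the right. -/
theorem IsAffineNCKernel.directSum (hG : IsAffineNCKernel O G)
    {a : Matrix (Fin n) (Fin n) A} {c : Matrix (Fin m) (Fin m) A} {a' : Matrix (Fin k) (Fin k) A}
    {c' : Matrix (Fin l) (Fin l) A} (ha : a ∈ O n) (hc : c ∈ O m) (ha' : a' ∈ O k)
    (hc' : c' ∈ O l) (h : blk a 0 c ∈ O (n + m)) (h' : blk a' 0 c' ∈ O (k + l))
    (P : Matrix (Fin n) (Fin k) J) (Q : Matrix (Fin n) (Fin l) J)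
    (R : Matrix (Fin m) (Fin k) J) (T : Matrix (Fin m) (Fin l) J) :
    G (n + m) (k + l) (blk a 0 c) (blk a' 0 c') (blkMat P Q R T) =
      blkMat (G n k a a' P) (G n l a c' Q) (G m k c a' R) (G m l c c' T) := by
  obtain ⟨p, q, r, t, hM⟩ :=
    exists_eq_blkMat (G (n + m) (k + l) (blk a 0 c) (blk a' 0 c') (blkMat P Q R T))
  have h11 := hG _ _ _ _ _ h _ ha _ h' _ ha' (blkRow 1 0) (blkCol 1 0)
    (by simp [blk_eq_blkMat, blkRow_mul_blkMat, mul_blkRow])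
    (by simp [blk_eq_blkMat, blkMat_mul_blkCol, blkCol_mul]) (blkMat P Q R T)
  have h12 := hG _ _ _ _ _ h _ ha _ h' _ hc' (blkRow 1 0) (blkCol 0 1)
    (by simp [blk_eq_blkMat, blkRow_mul_blkMat, mul_blkRow])
    (by simp [blk_eq_blkMat, blkMat_mul_blkCol, blkCol_mul]) (blkMat P Q R T)
  have h21 := hG _ _ _ _ _ h _ hc _ h' _ ha' (blkRow 0 1) (blkCol 1 0)
    (by simp [blk_eq_blkMat, blkRow_mul_blkMat, mul_blkRow])
    (by simp [blk_eq_blkMat, blkMat_mul_blkCol, blkCol_mul]) (blkMat P Q R T)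
  have h22 := hG _ _ _ _ _ h _ hc _ h' _ hc' (blkRow 0 1) (blkCol 0 1)
    (by simp [blk_eq_blkMat, blkRow_mul_blkMat, mul_blkRow])
    (by simp [blk_eq_blkMat, blkMat_mul_blkCol, blkCol_mul]) (blkMat P Q R T)
  rw [hM] at h11 h12 h21 h22 ⊢
  simp only [scalarMat_blkRow, scalarMat_blkCol, scalarMat_one, scalarMat_zero, blkRow_mul_blkMat,
    blkRow_mul_blkCol, Matrix.one_mul, Matrix.mul_one, Matrix.zero_mul, Matrix.mul_zero, add_zero,
    zero_add] at h11 h12 h21 h22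
  rw [h11, h12, h21, h22]

variable {a : Matrix (Fin n) (Fin n) A} {c : Matrix (Fin m) (Fin m) A}
  {b : Matrix (Fin n) (Fin m) A}

/-- The blocks of `G(X, X*)(1)` at `X = [a sb; 0 c]`. -/
theorem IsAffineNCKernel.apply_blk (hG : IsAffineNCKernel O G) (ha : a ∈ O n) (hc : c ∈ O m)
    (ha' : aᴴ ∈ O n) (hc' : cᴴ ∈ O m) (hZ : ∃ z : ℂ, z ≠ 0 ∧ blk a (z • b) c ∈ O (n + m))
    (hY : ∃ z : ℂ, z ≠ 0 ∧ blk cᴴ (z • bᴴ) aᴴ ∈ O (m + n)) {s : ℂ} (hs : star s = s)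
    (hX : blk a (s • b) c ∈ O (n + m)) (hX' : (blk a (s • b) c)ᴴ ∈ O (n + m)) :
    G (n + m) (n + m) (blk a (s • b) c) (blk a (s • b) c)ᴴ 1 =
      blkMat (G n n a aᴴ 1 + (s * s) • oneZeroDiffDiff O G a c cᴴ aᴴ b 1 bᴴ)
        (s • zeroDiffDiff O G a c cᴴ b 1) (s • oneDiffDiff O G c cᴴ aᴴ 1 bᴴ)
        (G m m c cᴴ 1) := by
  have hz0 : admScalar O a b c ≠ 0 := by rw [admScalar, dif_pos hZ]; exact hZ.choose_spec.1
  have hz : blk a (admScalar O a b c • b) c ∈ O (n + m) := by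
    rw [admScalar, dif_pos hZ]; exact hZ.choose_spec.2
  have hy0 : admScalar O cᴴ bᴴ aᴴ ≠ 0 := by rw [admScalar, dif_pos hY]; exact hY.choose_spec.1
  have hy : blk cᴴ (admScalar O cᴴ bᴴ aᴴ • bᴴ) aᴴ ∈ O (m + n) := by
    rw [admScalar, dif_pos hY]; exact hY.choose_spec.2
  simp only [oneZeroDiffDiff, zeroDiffDiff, oneDiffDiff]
  generalize admScalar O a b c = z at hz0 hz ⊢
  generalize admScalar O cᴴ bᴴ aᴴ = y at hy0 hy ⊢
  have hXH : (blk a (s • b) c)ᴴ = blkMat aᴴ 0 (s • bᴴ) cᴴ := by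
    rw [blk_eq_blkMat, conjTranspose_blkMat, Matrix.conjTranspose_smul, hs,
      Matrix.conjTranspose_zero]
  obtain ⟨p, q, r, t, hM⟩ :=
    exists_eq_blkMat (G (n + m) (n + m) (blk a (s • b) c) (blk a (s • b) c)ᴴ 1)
  rw [hM]
  -- `diag(z, s)` carries the parameter `s` to the chosen parameter `z`. It need not be invertible,
  -- so `s = 0` is allowed.
  have intZ : scalarMat A (blkMat (z • (1 : Matrix (Fin n) (Fin n) ℂ)) 0 0
      (s • (1 : Matrix (Fin m) (Fin m) ℂ))) * blk a (s • b) c = blk a (z • b) c *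
      scalarMat A (blkMat (z • (1 : Matrix (Fin n) (Fin n) ℂ)) 0 0
      (s • (1 : Matrix (Fin m) (Fin m) ℂ))) := by
    simp [blk_eq_blkMat, blkMat_mul_blkMat, smul_smul]
  -- The adjoint is block lower triangular; exchanging the two blocks makes it upper triangular, as
  -- the definition of `₁Δ` requires.
  have intY : (blk a (s • b) c)ᴴ * scalarMat A (blkMat 0 (y • (1 : Matrix (Fin n) (Fin n) ℂ))
      (s • (1 : Matrix (Fin m) (Fin m) ℂ)) 0) =
      scalarMat A (blkMat 0 (y • (1 : Matrix (Fin n) (Fin n) ℂ))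
      (s • (1 : Matrix (Fin m) (Fin m) ℂ)) 0) * blk cᴴ (y • bᴴ) aᴴ := by
    rw [hXH]
    simp [blk_eq_blkMat, blkMat_mul_blkMat, smul_smul, mul_comm]
  have intc : scalarMat A (blkRow (0 : Matrix (Fin m) (Fin n) ℂ) (1 : Matrix (Fin m) (Fin m) ℂ)) * blk a (s • b) c =
      c * scalarMat A (blkRow (0 : Matrix (Fin m) (Fin n) ℂ) (1 : Matrix (Fin m) (Fin m) ℂ)) := by
    simp [blk_eq_blkMat, blkRow_mul_blkMat, mul_blkRow]
  have intc' : (blk a (s • b) c)ᴴ * scalarMat A (blkCol (0 : Matrix (Fin n) (Fin m) ℂ) (1 : Matrix (Fin m) (Fin m) ℂ)) =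
      scalarMat A (blkCol (0 : Matrix (Fin n) (Fin m) ℂ) (1 : Matrix (Fin m) (Fin m) ℂ)) * cᴴ := by
    rw [hXH]
    simp [blkMat_mul_blkCol, blkCol_mul]
  have h22 := hG _ _ _ _ _ hX _ hc _ hX' _ hc' _ _ intc intc' 1
  have h12 := hG _ _ _ _ _ hX _ hz _ hX' _ hc' _ _ intZ intc' 1
  have h21 := hG _ _ _ _ _ hX _ hc _ hX' _ hy _ _ intc intY 1
  have h11 := hG _ _ _ _ _ hX _ hz _ hX' _ hy _ _ intZ intY 1
  -- The kernel value at the argument `[0 1; 0 0]` is `G(a,a*)(1)` in that corner; it supplies the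
  -- first summand of the `(1,1)` block.
  have h0 := hG _ _ _ _ _ ha _ hz _ ha' _ hy (blkCol 1 0) (blkRow 0 1)
    (by simp [blk_eq_blkMat, blkMat_mul_blkCol, blkCol_mul])
    (by simp [blk_eq_blkMat, blkRow_mul_blkMat, mul_blkRow]) 1
  simp only [scalarMat_blkRow, scalarMat_blkCol, scalarMat_one, scalarMat_zero, Matrix.mul_one,
    blkCol_mul _ _ (G n n a aᴴ 1), blkCol_mul_blkRow, Matrix.one_mul, Matrix.zero_mul,
    Matrix.mul_zero] at h0
  rw [hM] at h22 h12 h21 h11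
  simp only [scalarMat_blkRow, scalarMat_blkCol, scalarMat_blkMat, scalarMat_one, scalarMat_zero,
    scalarMat_smul, blkRow_mul_blkMat, blkMat_mul_blkMat, blkMat_mul_blkCol,
    Matrix.one_mul, Matrix.mul_one, Matrix.zero_mul, Matrix.mul_zero, add_zero,
    blkRow_mul_blkCol, zero_add, Matrix.smul_mul, Matrix.mul_smul, smul_smul, smul_zero] at h22 h12 h21 h11
  have e12 : (blkCol 0 (s • 1) : Matrix (Fin (n + m)) (Fin m) J) = s • blkCol 0 1 := by
    simp [smul_blkCol]
  have e21 : (blkRow (s • 1) 0 : Matrix (Fin m) (Fin (m + n)) J) = s • blkRow 1 0 := by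
    simp [smul_blkRow]
  -- The product of the two intertwiners splits into a part seen by `h0` and a part that produces
  -- `₁Δ₀ΔG`.
  have e11 : (blkMat 0 ((y * z) • 1) ((s * s) • 1) 0 : Matrix (Fin (n + m)) (Fin (m + n)) J) =
      (y * z) • blkMat 0 1 0 0 + (s * s) • blkMat 0 0 1 0 := by
    simp [smul_blkMat, blkMat_add]
  rw [e12, map_smul] at h12
  rw [e21, map_smul] at h21
  rw [e11, map_add, map_smul, map_smul, ← h0] at h11
  simp only [zeroTop_eq_blkCol, zeroRight_eq_blkRow, blkCol_zero_blkRow]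
  obtain ⟨u, u', hu⟩ := exists_eq_blkCol (G (n + m) m (blk a (z • b) c) cᴴ (blkCol 0 1))
  obtain ⟨v, v', hv⟩ := exists_eq_blkRow (G m (m + n) c (blk cᴴ (y • bᴴ) aᴴ) (blkRow 1 0))
  obtain ⟨w₁, w₂, w₃, w₄, hw⟩ := exists_eq_blkMat
    (G (n + m) (m + n) (blk a (z • b) c) (blk cᴴ (y • bᴴ) aᴴ) (blkMat 0 0 1 0))
  rw [hu, smul_blkCol, blkCol_inj] at h12
  rw [hv, smul_blkRow, blkRow_inj] at h21
  rw [hw, smul_blkMat, smul_blkMat, blkMat_add, blkMat_inj] at h11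
  rw [hu, hv, hw, blkMat_inj, Matrix.submatrix_smul]
  simp only [Pi.smul_apply, Matrix.submatrix_submatrix, Function.comp_id, Function.id_comp,
    blkMat_submatrix_castAdd_natAdd, blkCol_submatrix_castAdd, blkRow_submatrix_natAdd]
  have hyz : y * z ≠ 0 := mul_ne_zero hy0 hz0
  refine ⟨?_, ?_, ?_, h22⟩
  · refine smul_right_injective _ hyz (h11.2.1.trans ?_)
    simp only [smul_add, smul_smul]
    congr 2
    field_simp
  · rw [smul_comm, ← h12.1, inv_smul_smul₀ hz0]
  · rw [smul_comm, ← h21.2, inv_smul_smul₀ hy0]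

/-- With `U = [1 -s; 0 1]` one has `U (a ⊕ c) = X U`, so `G(X, X*)(1) = U G(a ⊕ c, a* ⊕ c*)(P) U*`
for `P = U⁻¹ (U⁻¹)* = [1+s² s; s 1]`. -/
theorem IsAffineNCKernel.apply_blk_sub (hG : IsAffineNCKernel O G)
    {a c : Matrix (Fin n) (Fin n) A} (ha : a ∈ O n) (hc : c ∈ O n)
    (ha' : aᴴ ∈ O n) (hc' : cᴴ ∈ O n) (h : blk a 0 c ∈ O (n + n)) (h' : blk aᴴ 0 cᴴ ∈ O (n + n))
    {s : ℂ} (hs : star s = s)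
    (hX : blk a (s • (a - c)) c ∈ O (n + n)) (hX' : (blk a (s • (a - c)) c)ᴴ ∈ O (n + n)) :
    G (n + n) (n + n) (blk a (s • (a - c)) c) (blk a (s • (a - c)) c)ᴴ 1 =
      blkMat 1 (-s • 1) 0 1 *
        blkMat ((1 + s * s) • G n n a aᴴ 1) (s • G n n a cᴴ 1) (s • G n n c aᴴ 1) (G n n c cᴴ 1) *
          (blkMat 1 (-s • 1) 0 1)ᴴ := by
  have hXH : (blk a (s • (a - c)) c)ᴴ = blkMat aᴴ 0 (s • (aᴴ - cᴴ)) cᴴ := by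
    rw [blk_eq_blkMat, conjTranspose_blkMat, Matrix.conjTranspose_smul, hs,
      Matrix.conjTranspose_zero, Matrix.conjTranspose_sub]
  have key := hG _ _ _ _ _ h _ hX _ h' _ hX' (blkMat 1 (-s • 1) 0 1) (blkMat 1 0 (-s • 1) 1)
    (by
      simp only [blk_eq_blkMat, scalarMat_blkMat, scalarMat_smul, scalarMat_one, scalarMat_zero,
        blkMat_mul_blkMat, blkMat_inj]
      simp [sub_eq_add_neg])
    (by
      rw [hXH]
      simp only [blk_eq_blkMat, scalarMat_blkMat, scalarMat_smul, scalarMat_one, scalarMat_zero,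
        blkMat_mul_blkMat, blkMat_inj]
      simp [sub_eq_add_neg])
    (blkMat ((1 + s * s) • 1) (s • 1) (s • 1) 1)
  rw [hG.directSum ha hc ha' hc' h h'] at key
  simp only [map_smul, scalarMat_blkMat, scalarMat_smul, scalarMat_one, scalarMat_zero] at key
  have e : (blkMat 1 (-s • 1) 0 1 * blkMat ((1 + s * s) • 1) (s • 1) (s • 1) 1 *
      blkMat 1 0 (-s • 1) 1 : Matrix (Fin (n + n)) (Fin (n + n)) J) = 1 := by
    simp only [blkMat_mul_blkMat, ← blkMat_one, blkMat_inj]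
    simp [smul_smul, add_smul]
  rw [e] at key
  rw [← key, conjTranspose_blkMat]
  simp [hs]

end KernelBlocks

/-! ### Openness along complex lines -/

section Open

variable {A : Type*} [CStarAlgebra A] [PartialOrder A] [StarOrderedRing A] {V : Submodule ℂ A}
  {n m : ℕ}

theorem EntriesIn.add {k l : ℕ} {p q : Matrix (Fin k) (Fin l) A} (hp : EntriesIn V p)
    (hq : EntriesIn V q) : EntriesIn V (p + q) := fun i j => V.add_mem (hp i j) (hq i j)

theorem EntriesIn.smul {k l : ℕ} {p : Matrix (Fin k) (Fin l) A} (z : ℂ)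
    (hp : EntriesIn V p) : EntriesIn V (z • p) := fun i j => V.smul_mem z (hp i j)

theorem entriesIn_blkMat_iff {k l : ℕ} {a : Matrix (Fin n) (Fin k) A} {b : Matrix (Fin n) (Fin l) A}
    {c : Matrix (Fin m) (Fin k) A} {d : Matrix (Fin m) (Fin l) A} :
    EntriesIn V (blkMat a b c d) ↔
      EntriesIn V a ∧ EntriesIn V b ∧ EntriesIn V c ∧ EntriesIn V d := by
  constructor
  · intro h
    refine ⟨fun i j => ?_, fun i j => ?_, fun i j => ?_, fun i j => ?_⟩
    · simpa [blkMat] using h (Fin.castAdd m i) (Fin.castAdd l j)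
    · simpa [blkMat] using h (Fin.castAdd m i) (Fin.natAdd k j)
    · simpa [blkMat] using h (Fin.natAdd n i) (Fin.castAdd l j)
    · simpa [blkMat] using h (Fin.natAdd n i) (Fin.natAdd k j)
  · rintro ⟨h1, h2, h3, h4⟩ i j
    obtain ⟨i, rfl⟩ := finSumFinEquiv.surjective i
    obtain ⟨j, rfl⟩ := finSumFinEquiv.surjective j
    rcases i with i | i <;> rcases j with j | j <;> simp [blkMat, h1 _ _, h2 _ _, h3 _ _, h4 _ _]

theorem opNorm_smul (z : ℂ) (q : Matrix (Fin n) (Fin m) A) : opNorm (z • q) = ‖z‖ * opNorm q :=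
  norm_smul z (CStarMatrix.ofMatrix q)

theorem IsUniformlyOpen.exists_ball {Ω : NCFamily A} (h : IsUniformlyOpen V Ω)
    {p : Matrix (Fin n) (Fin n) A} (hp : p ∈ Ω n) :
    ∃ r : ℝ, 0 < r ∧ ∀ x, EntriesIn V x → opNorm (x - p) < r → x ∈ Ω n := by
  obtain ⟨r, hr, hball⟩ := h n p hp
  refine ⟨r, hr, ?_⟩
  -- The ball is given at size `1 * n`; the size is generalized to `N` so that its equality with `n`
  -- can be substituted.
  have key : ∀ (N : ℕ) (e : N = n) (y : Matrix (Fin N) (Fin N) A),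
      (∀ i j, y i j = p (Fin.cast e i) (Fin.cast e j)) →
      (∀ x : Matrix (Fin N) (Fin N) A, EntriesIn V x → opNorm (x - y) < r → x ∈ Ω N) →
      ∀ x, EntriesIn V x → opNorm (x - p) < r → x ∈ Ω n := by
    rintro N rfl y hy hN
    obtain rfl : y = p := by ext i j; simp [hy]
    exact hN
  refine key (1 * n) (one_mul n) (ampl 1 p) (fun i j => ?_) (hball 1)
  have hval : ∀ i : Fin (1 * n), (finProdFinEquiv.symm i).2 = Fin.cast (one_mul n) i := by
    intro i
    have hi : (i : ℕ) < n := by have := i.2; omega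
    ext
    simp [finProdFinEquiv, Fin.modNat, Nat.mod_eq_of_lt hi]
  rw [ampl, Matrix.of_apply, if_pos (Subsingleton.elim _ _), hval, hval]

variable {J K : Type*} [CStarAlgebra J] [PartialOrder J] [StarOrderedRing J]
  [CStarAlgebra K] [PartialOrder K] [StarOrderedRing K]

/-- Only openness along a complex line is extracted from the three alternatives; the boundedness
conditions play no role. -/
theorem IsRegular.exists_add_smul_mem {O : NCFamily A} {G : KernelFamily A J K}
    (h : IsRegular V O G) (hO : ∀ n, ∀ a ∈ O n, EntriesIn V a) {p q : Matrix (Fin n) (Fin n) A}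
    (hp : p ∈ O n) (hq : EntriesIn V q) : ∃ z : ℂ, z ≠ 0 ∧ p + z • q ∈ O n := by
  have hcont : Continuous fun z : ℂ => p + z • q := by fun_prop
  have hnear : ∀ {P : ℂ → Prop}, (∀ᶠ z in nhds 0, P z) → ∃ z : ℂ, z ≠ 0 ∧ P z := by
    intro P hP
    obtain ⟨z, hz⟩ := ((hP.filter_mono nhdsWithin_le_nhds).and self_mem_nhdsWithin :
      ∀ᶠ z in nhdsWithin (0 : ℂ) {0}ᶜ, P z ∧ z ∈ ({0}ᶜ : Set ℂ)).exists
    exact ⟨z, hz.2, hz.1⟩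
  have hopen : ∀ U : Set (Matrix (Fin n) (Fin n) A), IsOpen U → p ∈ U →
      ∃ z : ℂ, z ≠ 0 ∧ p + z • q ∈ U := fun U hU hpU =>
    hnear (hcont.tendsto' 0 p (by simp) |>.eventually (hU.mem_nhds hpU))
  rcases h with ⟨h, -⟩ | ⟨h, -⟩ | ⟨h, -⟩
  · obtain ⟨r, hr, hball⟩ := h.exists_ball hp
    have h0 : ∀ᶠ z : ℂ in nhds 0, ‖z‖ * opNorm q < r := by
      have : Continuous fun z : ℂ => ‖z‖ * opNorm q := by fun_prop
      exact (this.tendsto' 0 0 (by simp)).eventually (gt_mem_nhds hr)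
    obtain ⟨z, hz0, hz⟩ := hnear h0
    refine ⟨z, hz0, hball _ ((hO n p hp).add (hq.smul z)) ?_⟩
    rwa [add_sub_cancel_left, opNorm_smul]
  · let X : Submodule ℂ (Matrix (Fin n) (Fin n) A) := Submodule.span ℂ {p, q}
    have hpX : p ∈ X := Submodule.subset_span (by simp)
    have hqX : q ∈ X := Submodule.subset_span (by simp)
    obtain ⟨U, hU, hUX⟩ := h n X
      (fun x hx => by
        obtain ⟨s, t, rfl⟩ := Submodule.mem_span_pair.1 hx
        exact ((hO n p hp).smul s).add (hq.smul t))
      (FiniteDimensional.span_of_finite ℂ (Set.toFinite _))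
    obtain ⟨z, hz0, hz⟩ := hopen U hU (hUX.le ⟨hp, hpX⟩).1
    exact ⟨z, hz0, (hUX.ge ⟨hz, X.add_mem hpX (X.smul_mem z hqX)⟩).1⟩
  · obtain ⟨U, hU, hUO⟩ := h n
    obtain ⟨z, hz0, hz⟩ := hopen U hU (hUO.le hp).1
    exact ⟨z, hz0, hUO.ge ⟨hz, (hO n p hp).add (hq.smul z)⟩⟩

end Open

/-! ### The domain of a kernel -/

section Domain

variable {A J K : Type*} [CStarAlgebra A] [PartialOrder A] [StarOrderedRing A]
  [CStarAlgebra J] [PartialOrder J] [StarOrderedRing J]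
  [CStarAlgebra K] [PartialOrder K] [StarOrderedRing K]
  {V : Submodule ℂ A} {O : NCFamily A} {G : KernelFamily A J K} {a₀ : A} {n m : ℕ}

theorem continuous_blk {X : Type*} [TopologicalSpace X] {a : X → Matrix (Fin n) (Fin n) A}
    {b : X → Matrix (Fin n) (Fin m) A} {c : X → Matrix (Fin m) (Fin m) A} (ha : Continuous a)
    (hb : Continuous b) (hc : Continuous c) : Continuous fun x => blk (a x) (b x) (c x) :=
  (ha.matrix_fromBlocks hb continuous_const hc).matrix_reindex _ _

theorem conjTranspose_blk_zero (a : Matrix (Fin n) (Fin n) A) (c : Matrix (Fin m) (Fin m) A) :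
    (blk a 0 c)ᴴ = blk aᴴ 0 cᴴ := by
  simp [blk_eq_blkMat, conjTranspose_blkMat]

theorem mem_positivitySet_of_mem_kernelDomain {a : Matrix (Fin n) (Fin n) A}
    (ha : a ∈ kernelDomain O G a₀ n) : a ∈ positivitySet O G n :=
  connectedComponentIn_subset _ _ ha

theorem blk_zero_mem_positivitySet (hO : IsNCSet V O) (hG : IsAffineNCKernel O G)
    {a : Matrix (Fin n) (Fin n) A} {c : Matrix (Fin m) (Fin m) A}
    (ha : a ∈ positivitySet O G n) (hc : c ∈ positivitySet O G m) :
    blk a 0 c ∈ positivitySet O G (n + m) := by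
  have h := hO.directSum n m a ha.1 c hc.1
  have h' := hO.directSum n m aᴴ ha.2.1 cᴴ hc.2.1
  refine ⟨h, by rwa [conjTranspose_blk_zero], ?_⟩
  rw [conjTranspose_blk_zero, ← blkMat_one, hG.directSum ha.1 hc.1 ha.2.1 hc.2.1 h h', map_zero,
    map_zero]
  exact matPos_blkMat_diag_iff.2 ⟨ha.2.2, hc.2.2⟩

/-- The direct sums of two components form a connected subset of the positivity set, and it contains
`a₀ ⊗ 1`. -/
theorem blk_zero_mem_kernelDomain (hO : IsNCSet V O) (hG : IsAffineNCKernel O G)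
    {a : Matrix (Fin n) (Fin n) A} {c : Matrix (Fin m) (Fin m) A}
    (ha : a ∈ kernelDomain O G a₀ n) (hc : c ∈ kernelDomain O G a₀ m) :
    blk a 0 c ∈ kernelDomain O G a₀ (n + m) := by
  have ha0 := mem_connectedComponentIn (connectedComponentIn_nonempty_iff.1 ⟨a, ha⟩)
  have hc0 := mem_connectedComponentIn (connectedComponentIn_nonempty_iff.1 ⟨c, hc⟩)
  have hpre : IsPreconnected ((fun p : Matrix (Fin n) (Fin n) A × Matrix (Fin m) (Fin m) A =>
      blk p.1 0 p.2) '' (kernelDomain O G a₀ n ×ˢ kernelDomain O G a₀ m)) :=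
    (isPreconnected_connectedComponentIn.prod isPreconnected_connectedComponentIn).image _
      (continuous_blk continuous_fst continuous_const continuous_snd).continuousOn
  have hdiag : (blk (Matrix.diagonal fun _ => a₀) 0 (Matrix.diagonal fun _ => a₀) :
      Matrix (Fin (n + m)) (Fin (n + m)) A) = Matrix.diagonal fun _ => a₀ := by
    rw [blk, Matrix.fromBlocks_diagonal, Matrix.reindex_apply, Matrix.submatrix_diagonal_equiv]
    congr 1
    ext i
    simp only [Function.comp_apply]
    rcases finSumFinEquiv.symm i with i | i <;> rfl
  refine hpre.subset_connectedComponentIn ⟨(_, _), ⟨ha0, hc0⟩, hdiag⟩ ?_ ⟨(a, c), ⟨ha, hc⟩, rfl⟩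
  rintro _ ⟨⟨x, y⟩, ⟨hx, hy⟩, rfl⟩
  exact blk_zero_mem_positivitySet hO hG (mem_positivitySet_of_mem_kernelDomain hx)
    (mem_positivitySet_of_mem_kernelDomain hy)

theorem mem_kernelDomain_of_path {γ : ℝ → Matrix (Fin n) (Fin n) A} (hγ : Continuous γ) {s : ℝ}
    (hs : 0 ≤ s) (h0 : γ 0 ∈ kernelDomain O G a₀ n)
    (h : ∀ t ∈ Set.Icc 0 s, γ t ∈ positivitySet O G n) : γ s ∈ kernelDomain O G a₀ n := by
  rw [kernelDomain, connectedComponentIn_eq h0]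
  refine (isPreconnected_Icc.image γ hγ.continuousOn).subset_connectedComponentIn
    ⟨0, ⟨le_rfl, hs⟩, rfl⟩ ?_ ⟨s, ⟨hs, le_rfl⟩, rfl⟩
  rintro _ ⟨t, ht, rfl⟩
  exact h t ht

theorem ncDelta_kernelDomain {L : Type*} [CStarAlgebra L] [PartialOrder L] [StarOrderedRing L]
    (hO : IsNCSet V O) (hG : IsAffineNCKernel O G)
    {a : Matrix (Fin n) (Fin n) A} {c : Matrix (Fin m) (Fin m) A} {b : Matrix (Fin n) (Fin m) A}
    (ha : a ∈ kernelDomain O G a₀ n) (hc : c ∈ kernelDomain O G a₀ m) {x : L}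
    (hx : IsSelfAdjoint x)
    (hb : ∀ s : ℂ, blk a (s • b) c ∈ O (n + m) ∧ (blk a (s • b) c)ᴴ ∈ O (n + m))
    (hpos : ∀ s : ℝ, MatPos (G (n + m) (n + m) (blk a ((s : ℂ) • b) c)
      (blk a ((s : ℂ) • b) c)ᴴ 1) ↔ IsStrictlyPositive (1 - (s ^ 2) • x)) :
    ncDelta (kernelDomain O G a₀) a c b = sqrtSupSpectrum x := by
  refine ncDelta_eq_sqrtSupSpectrum hx fun s =>
    ⟨fun h => (hpos s).1 (mem_positivitySet_of_mem_kernelDomain h).2.2, fun h => ?_⟩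
  refine mem_kernelDomain_of_path (γ := fun t : ℝ => blk a ((t : ℂ) • b) c)
    (continuous_blk continuous_const (by fun_prop) continuous_const) s.coe_nonneg
    (by simpa using blk_zero_mem_kernelDomain hO hG ha hc) fun t ht =>
    ⟨(hb t).1, (hb t).2, (hpos t).2 ?_⟩
  -- The condition `s * sqrtSupSpectrum x < 1` is inherited by every `t ≤ s`, so the whole segment
  -- stays positive.
  lift t to ℝ≥0 using ht.1
  rw [isStrictlyPositive_one_sub_sq_smul_iff hx] at h ⊢
  exact lt_of_le_of_lt (mul_le_mul_left (by exact_mod_cast ht.2) _) h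

end Domain

/-! ### The kernel formulas -/

section Formulas

variable {A J K : Type*} [CStarAlgebra A] [PartialOrder A] [StarOrderedRing A]
  [CStarAlgebra J] [PartialOrder J] [StarOrderedRing J]
  [CStarAlgebra K] [PartialOrder K] [StarOrderedRing K]
  {V : Submodule ℂ A} {O : NCFamily A} {G : KernelFamily A J K} {a₀ : A} {n m : ℕ}

theorem matPos_sub_smul_iff {g : Matrix (Fin n) (Fin n) K} (hg : MatPos g)
    (x : Matrix (Fin n) (Fin n) K) (s : ℝ) :
    MatPos (g - ((s : ℂ) * s) • x) ↔
      IsStrictlyPositive (1 - s ^ 2 • sandwich (CStarMatrix.ofMatrix g) (CStarMatrix.ofMatrix x)) := by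
  have e : CStarMatrix.ofMatrix (g - ((s : ℂ) * s) • x) =
      CStarMatrix.ofMatrix g - s ^ 2 • CStarMatrix.ofMatrix x := by
    rw [ofMatrix_sub, ← Complex.ofReal_mul, ← pow_two]
    rfl
  rw [MatPos, e]
  exact isStrictlyPositive_sub_smul_iff hg _ _

theorem conjTranspose_apply_conjTranspose_one (hH : IsHermitianKernel O G)
    {a c : Matrix (Fin n) (Fin n) A} (ha : a ∈ O n) (ha' : aᴴ ∈ O n) (hc : c ∈ O n)
    (hc' : cᴴ ∈ O n) : (G n n a cᴴ 1)ᴴ = G n n c aᴴ 1 := by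
  have := hH n a ha cᴴ hc' ha' (by simpa using hc) 1 (by simp)
  rwa [Matrix.conjTranspose_conjTranspose] at this

theorem conjTranspose_crossTerm (hH : IsHermitianKernel O G) {a c : Matrix (Fin n) (Fin n) A}
    (ha : a ∈ positivitySet O G n) (hc : c ∈ positivitySet O G n) :
    (crossTerm G a c)ᴴ = crossTerm G a c := by
  have h := conjTranspose_apply_conjTranspose_one hH ha.1 ha.2.1 hc.1 hc.2.1
  have h' := conjTranspose_apply_conjTranspose_one hH hc.1 hc.2.1 ha.1 ha.2.1
  rw [crossTerm, Matrix.conjTranspose_mul, Matrix.conjTranspose_mul, h, h',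
    MatPos.conjTranspose_ringInverse hc.2.2, Matrix.mul_assoc]

theorem pickElement_sub_one {a : Matrix (Fin n) (Fin n) A} (ha : a ∈ positivitySet O G n)
    (c : Matrix (Fin n) (Fin n) A) :
    pickElement G a c - 1 = sandwich (CStarMatrix.ofMatrix (G n n a aᴴ 1))
      (CStarMatrix.ofMatrix (crossTerm G a c - G n n a aᴴ 1)) := by
  rw [ofMatrix_sub, sandwich_sub, sandwich_self ha.2.2]
  rfl

theorem isSelfAdjoint_pickElement_sub_one (hH : IsHermitianKernel O G)
    {a c : Matrix (Fin n) (Fin n) A}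
    (ha : a ∈ positivitySet O G n) (hc : c ∈ positivitySet O G n) :
    IsSelfAdjoint (pickElement G a c - 1) :=
  (isSelfAdjoint_sandwich (x := CStarMatrix.ofMatrix (crossTerm G a c))
    (conjTranspose_crossTerm hH ha hc)).sub (IsSelfAdjoint.one _)

/-- Positivity of `G(X, X*)(1)` at `X = [a s(a - c); 0 c]`. -/
theorem matPos_apply_blk_sub_iff (hO : IsNCSet V O) (hG : IsAffineNCKernel O G)
    (hH : IsHermitianKernel O G) {a c : Matrix (Fin n) (Fin n) A}
    (ha : a ∈ positivitySet O G n) (hc : c ∈ positivitySet O G n) {s : ℝ}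
    (hX : blk a ((s : ℂ) • (a - c)) c ∈ O (n + n))
    (hX' : (blk a ((s : ℂ) • (a - c)) c)ᴴ ∈ O (n + n)) :
    MatPos (G (n + n) (n + n) (blk a ((s : ℂ) • (a - c)) c)
      (blk a ((s : ℂ) • (a - c)) c)ᴴ 1) ↔
        IsStrictlyPositive (1 - s ^ 2 • (pickElement G a c - 1)) := by
  have hu : IsUnit (blkMat 1 (-(s : ℂ) • 1) 0 1 : Matrix (Fin (n + n)) (Fin (n + n)) K) := by
    refine isUnit_iff_exists.2 ⟨blkMat 1 ((s : ℂ) • 1) 0 1, ?_, ?_⟩ <;>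
      simp [blkMat_mul_blkMat, blkMat_one]
  have hb : ((s : ℂ) • G n n a cᴴ 1)ᴴ = (s : ℂ) • G n n c aᴴ 1 := by
    rw [Matrix.conjTranspose_smul,
      conjTranspose_apply_conjTranspose_one hH ha.1 ha.2.1 hc.1 hc.2.1]
    simp
  rw [hG.apply_blk_sub ha.1 hc.1 ha.2.1 hc.2.1 (hO.directSum n n a ha.1 c hc.1)
    (hO.directSum n n _ ha.2.1 _ hc.2.1) (by simp) hX hX', matPos_conj_iff hu,
    matPos_blkMat_iff hc.2.2 hb, pickElement_sub_one ha, ← matPos_sub_smul_iff ha.2.2]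
  congr! 1
  rw [crossTerm, add_smul, one_smul, smul_sub]
  simp only [Matrix.smul_mul, Matrix.mul_smul, smul_smul]
  abel

/-- Positivity of `G(X, X*)(1)` at `X = [a sb; 0 c]`. -/
theorem matPos_apply_blk_iff (hO : IsNCSet V O) (hG : IsAffineNCKernel O G)
    (hreg : IsRegular V O G) (hH : IsHermitianKernel O G) {a : Matrix (Fin n) (Fin n) A}
    {c : Matrix (Fin m) (Fin m) A} {b : Matrix (Fin n) (Fin m) A}
    (ha : a ∈ positivitySet O G n) (hc : c ∈ positivitySet O G m)
    (hb : ∀ s : ℂ, blk a (s • b) c ∈ O (n + m) ∧ (blk a (s • b) c)ᴴ ∈ O (n + m)) :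
    IsSelfAdjoint (infinitesimalElement O G a c b) ∧
    ∀ s : ℝ, MatPos (G (n + m) (n + m) (blk a ((s : ℂ) • b) c) (blk a ((s : ℂ) • b) c)ᴴ 1) ↔
      IsStrictlyPositive (1 - s ^ 2 • infinitesimalElement O G a c b) := by
  have hZ : ∃ z : ℂ, z ≠ 0 ∧ blk a (z • b) c ∈ O (n + m) := ⟨1, one_ne_zero, (hb 1).1⟩
  -- `V` need not be closed under the adjoint; the entries of `bᴴ` lie in it because `[a b; 0 c]ᴴ`
  -- belongs to `O`.
  have hbV : EntriesIn V bᴴ := by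
    have := hO.entries _ _ (hb 1).2
    rw [blk_eq_blkMat, conjTranspose_blkMat, entriesIn_blkMat_iff, one_smul] at this
    exact this.2.2.1
  -- `[c* zb*; 0 a*]` is not covered by `hb`, so it is reached from `c* ⊕ a*` by openness.
  have hY : ∃ z : ℂ, z ≠ 0 ∧ blk cᴴ (z • bᴴ) aᴴ ∈ O (m + n) := by
    have h0 := hO.directSum m n _ hc.2.1 _ ha.2.1
    obtain ⟨z, hz, h⟩ := hreg.exists_add_smul_mem hO.entries h0 (q := blkMat 0 bᴴ 0 0)
      (entriesIn_blkMat_iff.2 ⟨fun _ _ => V.zero_mem, hbV, fun _ _ => V.zero_mem,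
        fun _ _ => V.zero_mem⟩)
    refine ⟨z, hz, ?_⟩
    rw [smul_blkMat, blk_eq_blkMat, blkMat_add] at h
    simpa [blk_eq_blkMat] using h
  have key := fun s : ℝ => hG.apply_blk ha.1 hc.1 ha.2.1 hc.2.1 hZ hY
    (s := (s : ℂ)) (by simp) (hb s).1 (hb s).2
  rw [infinitesimalElement]
  set w := oneZeroDiffDiff O G a c cᴴ aᴴ b 1 bᴴ
  set u := zeroDiffDiff O G a c cᴴ b 1
  set v := oneDiffDiff O G c cᴴ aᴴ 1 bᴴ
  -- Comparing blocks of the selfadjoint matrix `G(X, X*)(1)` at `s = 1` gives the symmetry of all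
  -- difference-differentials at once.
  have hherm := conjTranspose_apply_conjTranspose_one hH (hb (1 : ℝ)).1 (hb (1 : ℝ)).2
    (hb (1 : ℝ)).1 (hb (1 : ℝ)).2
  rw [key 1, conjTranspose_blkMat, blkMat_inj] at hherm
  simp only [Complex.ofReal_one, one_smul, mul_one, Matrix.conjTranspose_add,
    MatPos.conjTranspose_eq ha.2.2, add_right_inj] at hherm
  obtain ⟨hw, hv, hu, -⟩ := hherm
  constructor
  · refine isSelfAdjoint_sandwich ?_
    change (u * Ring.inverse (G m m c cᴴ 1) * v - w)ᴴ = _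
    rw [Matrix.conjTranspose_sub, Matrix.conjTranspose_mul, Matrix.conjTranspose_mul, hw, hu, hv,
      MatPos.conjTranspose_ringInverse hc.2.2, Matrix.mul_assoc]
    rfl
  · intro s
    rw [key s, matPos_blkMat_iff hc.2.2 (by simp [hu]), ← matPos_sub_smul_iff ha.2.2]
    congr! 1
    simp only [Matrix.smul_mul, Matrix.mul_smul, smul_smul, smul_sub]
    abel

theorem IsTriangularlyDefined.smul {D : NCFamily A} (h : IsTriangularlyDefined V O D)
    {a : Matrix (Fin n) (Fin n) A} {c : Matrix (Fin m) (Fin m) A} {b : Matrix (Fin n) (Fin m) A}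
    (ha : a ∈ D n) (hc : c ∈ D m) (hb : EntriesIn V b) (s : ℂ) :
    blk a (s • b) c ∈ O (n + m) ∧ (blk a (s • b) c)ᴴ ∈ O (n + m) :=
  h n m a ha c hc _ (hb.smul s)

theorem hasKernelFormula (hO : IsNCSet V O) (hG : IsAffineNCKernel O G)
    (hreg : IsRegular V O G) (hH : IsHermitianKernel O G)
    (h : IsTriangularlyDefined V O (kernelDomain O G a₀)) :
    HasKernelFormula V O G (kernelDomain O G a₀) := by
  constructor
  · intro n m a ha c hc b hb
    have hb' := fun s => h.smul ha hc hb s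
    have key := matPos_apply_blk_iff hO hG hreg hH (mem_positivitySet_of_mem_kernelDomain ha)
      (mem_positivitySet_of_mem_kernelDomain hc) hb'
    exact ncDelta_kernelDomain hO hG ha hc key.1 hb' key.2
  · intro n a ha c hc
    have ha' := mem_positivitySet_of_mem_kernelDomain ha
    have hc' := mem_positivitySet_of_mem_kernelDomain hc
    have hb : EntriesIn V (a - c) := fun i j =>
      V.sub_mem (hO.entries n a ha'.1 i j) (hO.entries n c hc'.1 i j)
    have hb' := fun s => h.smul ha hc hb s
    exact ncDelta_kernelDomain hO hG ha hc (isSelfAdjoint_pickElement_sub_one hH ha' hc') hb'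
      fun s => matPos_apply_blk_sub_iff hO hG hH ha' hc' (hb' s).1 (hb' s).2

theorem sqrtSupSpectrum_pickElement_le (hO : IsNCSet V O) (hG : IsAffineNCKernel O G)
    (hH : IsHermitianKernel O G) {a c : Matrix (Fin n) (Fin n) A}
    (ha : a ∈ kernelDomain O G a₀ n) (hc : c ∈ kernelDomain O G a₀ n) :
    sqrtSupSpectrum (pickElement G a c - 1) ≤ ncDeltaTilde (kernelDomain O G a₀) a c := by
  have ha' := mem_positivitySet_of_mem_kernelDomain ha
  have hc' := mem_positivitySet_of_mem_kernelDomain hc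
  refine sqrtSupSpectrum_le_ncDelta (isSelfAdjoint_pickElement_sub_one hH ha' hc') fun s hs => ?_
  have hs' := mem_positivitySet_of_mem_kernelDomain hs
  exact (matPos_apply_blk_sub_iff hO hG hH ha' hc' hs'.1 hs'.2.1).1 hs'.2.2

/-- By the Hermitian symmetry the cross term is `B* C⁻¹ B` with `C = G(c,c*)(1)`, and `C⁻¹ = C⁻¹ C
C⁻¹` is positive. -/
theorem pickElement_nonneg (hH : IsHermitianKernel O G) {a c : Matrix (Fin n) (Fin n) A}
    (ha : a ∈ positivitySet O G n) (hc : c ∈ positivitySet O G n) : 0 ≤ pickElement G a c := by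
  refine (sandwich_nonneg_iff ha.2.2).2 ?_
  have h := conjTranspose_apply_conjTranspose_one hH hc.1 hc.2.1 ha.1 ha.2.1
  rw [crossTerm, ← h]
  refine ofMatrix_conj_nonneg ?_ _
  have hr := IsStrictlyPositive.nonneg hc.2.2
  have h2 := ofMatrix_conj_nonneg hr (Ring.inverse (G n n c cᴴ 1))
  rwa [MatPos.conjTranspose_ringInverse hc.2.2,
    Ring.inverse_mul_cancel _ (MatPos.isUnit hc.2.2), Matrix.one_mul] at h2

theorem pickElement_self {a : Matrix (Fin n) (Fin n) A} (ha : a ∈ positivitySet O G n) :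
    pickElement G a a = 1 := by
  rw [pickElement, crossTerm, Ring.mul_inverse_cancel _ (MatPos.isUnit ha.2.2), Matrix.one_mul,
    sandwich_self ha.2.2]

theorem crossTerm_sub_le_iff {a c : Matrix (Fin n) (Fin n) A} (ha : a ∈ positivitySet O G n)
    (r : ℝ) :
    CStarMatrix.ofMatrix (crossTerm G a c - G n n a aᴴ 1) ≤
      r • CStarMatrix.ofMatrix (G n n a aᴴ 1) ↔
      pickElement G a c - 1 ≤ r • (1 : CStarMatrix (Fin n) (Fin n) K) := by
  rw [pickElement_sub_one ha]
  exact le_smul_iff_sandwich_le ha.2.2 _ _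

end Formulas

/-! ### Contractivity of nc maps -/

section Maps

variable {A B : Type*} [Ring A] [Algebra ℂ A] [Ring B] [Algebra ℂ B]
  {D : NCFamily A} {E : NCFamily B} {f : ∀ n : ℕ, Matrix (Fin n) (Fin n) A → Matrix (Fin n) (Fin n) B}
  {n m : ℕ} {a : Matrix (Fin n) (Fin n) A} {c : Matrix (Fin m) (Fin m) A}
  {b : Matrix (Fin n) (Fin m) A}

theorem IsNCMap.exists_apply_blk (hf : IsNCMap D E f) (ha : a ∈ D n) (hc : c ∈ D m)
    (h : blk a b c ∈ D (n + m)) : ∃ d, f (n + m) (blk a b c) = blk (f n a) d (f m c) := by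
  obtain ⟨p, q, r, t, hM⟩ := exists_eq_blkMat (f (n + m) (blk a b c))
  have h1 := hf.intertwine _ _ _ h _ ha (blkCol 1 0)
    (by simp [blk_eq_blkMat, blkMat_mul_blkCol, blkCol_mul])
  have h2 := hf.intertwine _ _ _ hc _ h (blkRow 0 1)
    (by simp [blk_eq_blkMat, blkRow_mul_blkMat, mul_blkRow])
  rw [hM] at h1 h2
  simp only [scalarMat_blkRow, scalarMat_blkCol, scalarMat_one, scalarMat_zero, blkMat_mul_blkCol,
    blkRow_mul_blkMat, blkCol_mul, mul_blkRow, Matrix.one_mul, Matrix.mul_one, Matrix.zero_mul,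
    Matrix.mul_zero, add_zero, zero_add, blkCol_inj, blkRow_inj] at h1 h2
  exact ⟨q, by rw [hM, blk_eq_blkMat, h1.1, h1.2, h2.2]⟩

theorem IsNCMap.apply_blk_smul (hf : IsNCMap D E f) (ha : a ∈ D n) (hc : c ∈ D m)
    (hz : ∃ z : ℂ, z ≠ 0 ∧ blk a (z • b) c ∈ D (n + m)) {s : ℂ}
    (hs : blk a (s • b) c ∈ D (n + m)) :
    f (n + m) (blk a (s • b) c) = blk (f n a) (s • diffDiff D f a c b) (f m c) := by
  have hz0 : admScalar D a b c ≠ 0 := by rw [admScalar, dif_pos hz]; exact hz.choose_spec.1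
  have hzD : blk a (admScalar D a b c • b) c ∈ D (n + m) := by
    rw [admScalar, dif_pos hz]; exact hz.choose_spec.2
  rw [diffDiff]
  generalize admScalar D a b c = z at hz0 hzD ⊢
  obtain ⟨d, hd⟩ := hf.exists_apply_blk ha hc hs
  obtain ⟨e, he⟩ := hf.exists_apply_blk ha hc hzD
  -- `diag(s, z)` intertwines the triangular matrices with parameters `s` and `z`, which gives
  -- homogeneity in the upper corner.
  have key := hf.intertwine _ _ _ hs _ hzD (blkMat (s • 1) 0 0 (z • 1))
    (by simp [blk_eq_blkMat, blkMat_mul_blkMat, smul_smul, mul_comm])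
  rw [hd, he] at key
  simp only [blk_eq_blkMat, scalarMat_blkMat, scalarMat_smul, scalarMat_one, scalarMat_zero,
    blkMat_mul_blkMat, blkMat_inj] at key
  have h12 : z • d = s • e := by simpa using key.2.1
  rw [hd, he, blk_eq_blkMat, blk_eq_blkMat, blk_eq_blkMat, blkMat_submatrix_castAdd_natAdd,
    smul_comm s, ← h12, inv_smul_smul₀ hz0]

theorem IsNCMap.ncDelta_diffDiff_le (hf : IsNCMap D E f) (ha : a ∈ D n) (hc : c ∈ D m) :
    ncDelta E (f n a) (f m c) (diffDiff D f a c b) ≤ ncDelta D a c b := by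
  refine ENNReal.inv_le_inv.2 (sSup_le fun t ht => ?_)
  -- A positive admissible `t` provides the nonzero scalar without which `diffDiff` is only a
  -- default value; `t = 0` contributes nothing to the supremum.
  rcases eq_or_ne t 0 with rfl | h0
  · exact zero_le
  obtain ⟨r, hr0, hrt⟩ := ENNReal.lt_iff_exists_nnreal_btwn.1 (pos_iff_ne_zero.2 h0)
  have hz : ∃ z : ℂ, z ≠ 0 ∧ blk a (z • b) c ∈ D (n + m) := by
    refine ⟨((r : ℝ) : ℂ), ?_, ht r hrt.le⟩
    have : r ≠ 0 := by rintro rfl; simp at hr0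
    exact_mod_cast this
  refine le_sSup fun s hs => ?_
  rw [← hf.apply_blk_smul ha hc hz (ht s hs)]
  exact hf.mapsTo _ _ (ht s hs)

theorem IsNCMap.apply_blk_sub (hf : IsNCMap D E f) {a c : Matrix (Fin n) (Fin n) A}
    (ha : a ∈ D n) (hc : c ∈ D n) {s : ℂ} (hs : blk a (s • (a - c)) c ∈ D (n + n)) :
    f (n + n) (blk a (s • (a - c)) c) = blk (f n a) (s • (f n a - f n c)) (f n c) := by
  obtain ⟨d, hd⟩ := hf.exists_apply_blk ha hc hs
  -- The column `[-s; 1]` spans an invariant subspace on which `[a s(a-c); 0 c]` acts as `c`; this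
  -- determines the corner of the image without `Δf`.
  have key := hf.intertwine _ _ _ hs _ hc (blkCol (-s • 1) 1)
    (by
      simp only [blk_eq_blkMat, scalarMat_blkCol, scalarMat_smul, scalarMat_one,
        blkMat_mul_blkCol, blkCol_mul, blkCol_inj]
      simp [sub_eq_add_neg])
  rw [hd] at key
  simp only [blk_eq_blkMat, scalarMat_blkCol, scalarMat_smul, scalarMat_one,
    blkMat_mul_blkCol, blkCol_mul, blkCol_inj] at key
  have h : -(s • f n a) + d = -(s • f n c) := by simpa using key.1
  rw [hd, smul_sub, sub_eq_add_neg, ← h, add_neg_cancel_left]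

theorem IsNCMap.ncDeltaTilde_le (hf : IsNCMap D E f) {a c : Matrix (Fin n) (Fin n) A}
    (ha : a ∈ D n) (hc : c ∈ D n) :
    ncDeltaTilde E (f n a) (f n c) ≤ ncDeltaTilde D a c := by
  refine ENNReal.inv_le_inv.2 (sSup_le_sSup fun t ht s hs => ?_)
  rw [← hf.apply_blk_sub ha hc (ht s hs)]
  exact hf.mapsTo _ _ (ht s hs)

end Maps

/-! ### Norm bounds from the spectral quantity -/

section Norm

variable {L : Type*} [CStarAlgebra L] [PartialOrder L] [StarOrderedRing L] {x : L}

theorem norm_le_one_add_iff (hx : 0 ≤ x) {r : ℝ} (hr : 0 ≤ r) :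
    ‖x‖ ≤ 1 + r ↔ sqrtSupSpectrum (x - 1) ≤ ENNReal.ofReal (Real.sqrt r) := by
  have hsa : IsSelfAdjoint (x - 1) := hx.isSelfAdjoint.sub (IsSelfAdjoint.one L)
  rw [← le_smul_one_iff_sqrtSupSpectrum_le hsa hr, CStarAlgebra.norm_le_iff_le_algebraMap x
    (by linarith) hx, map_add, map_one, Algebra.algebraMap_eq_smul_one, sub_le_iff_le_add']

theorem sqrtSupSpectrum_le_sqrt_norm (hx : IsSelfAdjoint x) :
    sqrtSupSpectrum x ≤ ENNReal.ofReal (Real.sqrt ‖x‖) := by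
  rw [← le_smul_one_iff_sqrtSupSpectrum_le hx (norm_nonneg x), ← Algebra.algebraMap_eq_smul_one]
  exact hx.le_algebraMap_norm_self

variable {L' : Type*} [CStarAlgebra L'] [PartialOrder L'] [StarOrderedRing L'] {y : L'}

/-- The spectral quantity of `x - 1` does not see how far `x` lies below `1`, hence the maximum with
`1`. -/
theorem norm_le_max_one_norm (hx : 0 ≤ x) (hy : 0 ≤ y)
    (h : sqrtSupSpectrum (y - 1) ≤ sqrtSupSpectrum (x - 1)) : ‖y‖ ≤ max 1 ‖x‖ := by
  have hr : 0 ≤ max 1 ‖x‖ - 1 := sub_nonneg.2 (le_max_left _ _)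
  have h1 : 1 + (max 1 ‖x‖ - 1) = max 1 ‖x‖ := by ring
  have hx' := (norm_le_one_add_iff hx hr).1 (by rw [h1]; exact le_max_right _ _)
  have := (norm_le_one_add_iff hy hr).2 (h.trans hx')
  rwa [h1] at this

theorem one_le_norm_of_sqrtSupSpectrum_ne_zero (hx : 0 ≤ x) (h : sqrtSupSpectrum (x - 1) ≠ 0) :
    1 ≤ ‖x‖ := by
  by_contra! hlt
  refine h (le_antisymm ?_ zero_le)
  simpa using (norm_le_one_add_iff hx le_rfl).1 (by linarith)

end Norm

/-- Needed for `a = c`, where both elements are the identity. Its norm is `0` in a zero algebra and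
`1` otherwise, so nontriviality of `K` matters at positive levels; at level `0` both norms vanish.
-/
theorem norm_one_cstarMatrix_le {K K' : Type*} [CStarAlgebra K] [PartialOrder K] [StarOrderedRing K]
    [Nontrivial K] [CStarAlgebra K'] [PartialOrder K'] [StarOrderedRing K'] (n : ℕ) :
    ‖(1 : CStarMatrix (Fin n) (Fin n) K')‖ ≤ ‖(1 : CStarMatrix (Fin n) (Fin n) K)‖ := by
  rcases subsingleton_or_nontrivial (CStarMatrix (Fin n) (Fin n) K') with h | h
  · rw [Subsingleton.elim (1 : CStarMatrix (Fin n) (Fin n) K') 0, norm_zero]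
    exact norm_nonneg _
  · rcases n with _ | n
    · exact absurd (inferInstanceAs (Subsingleton (Matrix (Fin 0) (Fin 0) K')))
        (not_subsingleton_iff_nontrivial.2 h)
    · rw [CStarRing.norm_one, CStarRing.norm_one]

end NCKernel

theorem mainTheorem5
    {A : Type*} [CStarAlgebra A] [PartialOrder A] [StarOrderedRing A]
    {B : Type*} [CStarAlgebra B] [PartialOrder B] [StarOrderedRing B]
    {J : Type*} [CStarAlgebra J] [PartialOrder J] [StarOrderedRing J]
    {K : Type*} [CStarAlgebra K] [PartialOrder K] [StarOrderedRing K] [Nontrivial K]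
    {J' : Type*} [CStarAlgebra J'] [PartialOrder J'] [StarOrderedRing J']
    {K' : Type*} [CStarAlgebra K'] [PartialOrder K'] [StarOrderedRing K']
    -- the kernel `G` on the nc set `O` over the operator space `V ⊆ A`, and the domain it defines
    (V : Submodule ℂ A) (O : NCKernel.NCFamily A) (G : NCKernel.KernelFamily A J K)
    (hO : NCKernel.IsNCSet V O) (hG : NCKernel.IsAffineNCKernel O G)
    (hGreg : NCKernel.IsRegular V O G) (hGherm : NCKernel.IsHermitianKernel O G)
    (a₀ : A) (ha₀ : (Matrix.diagonal fun _ : Fin 1 => a₀) ∈ NCKernel.positivitySet O G 1)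
    (DG : NCKernel.NCFamily A) (hDG : DG = NCKernel.kernelDomain O G a₀)
    -- the kernel `H` on the nc set `O'` over the operator space `W ⊆ B`, and the domain it defines
    (W : Submodule ℂ B) (O' : NCKernel.NCFamily B) (H : NCKernel.KernelFamily B J' K')
    (hO' : NCKernel.IsNCSet W O') (hH : NCKernel.IsAffineNCKernel O' H)
    (hHreg : NCKernel.IsRegular W O' H) (hHherm : NCKernel.IsHermitianKernel O' H)
    (b₀ : B) (hb₀ : (Matrix.diagonal fun _ : Fin 1 => b₀) ∈ NCKernel.positivitySet O' H 1)
    (DH : NCKernel.NCFamily B) (hDH : DH = NCKernel.kernelDomain O' H b₀)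
    -- the nc map
    (f : ∀ n : ℕ, Matrix (Fin n) (Fin n) A → Matrix (Fin n) (Fin n) B)
    (hf : NCKernel.IsNCMap DG DH f) :
    -- explicit formulas for `δ` and `δ̃` on both domains
    (NCKernel.IsTriangularlyDefined V O DG → NCKernel.HasKernelFormula V O G DG) ∧
    (NCKernel.IsTriangularlyDefined W O' DH → NCKernel.HasKernelFormula W O' H DH) ∧
    -- `f` contracts `δ`
    (∀ n m, ∀ a ∈ DG n, ∀ c ∈ DG m, ∀ b : Matrix (Fin n) (Fin m) A, NCKernel.EntriesIn V b →
      NCKernel.ncDelta DH (f n a) (f m c) (NCKernel.diffDiff DG f a c b) ≤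
        NCKernel.ncDelta DG a c b) ∧
    -- `f` contracts `δ̃`
    (∀ n, ∀ a ∈ DG n, ∀ c ∈ DG n,
      NCKernel.ncDeltaTilde DH (f n a) (f n c) ≤ NCKernel.ncDeltaTilde DG a c) ∧
    -- the norm inequality and the order inequality
    (NCKernel.IsTriangularlyDefined V O DG →
      ∀ n, ∀ a ∈ DG n, ∀ c ∈ DG n,
        ‖NCKernel.pickElement H (f n a) (f n c)‖ ≤ max 1 ‖NCKernel.pickElement G a c‖ ∧
        ((a = c ∨ NCKernel.ncDeltaTilde DG a c ≠ 0) →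
          ‖NCKernel.pickElement H (f n a) (f n c)‖ ≤ ‖NCKernel.pickElement G a c‖) ∧
        CStarMatrix.ofMatrix
            (NCKernel.crossTerm H (f n a) (f n c) - H n n (f n a) (f n a)ᴴ 1) ≤
          ‖NCKernel.pickElement G a c - 1‖ • CStarMatrix.ofMatrix (H n n (f n a) (f n a)ᴴ 1)) := by
  subst hDG hDH
  refine ⟨NCKernel.hasKernelFormula hO hG hGreg hGherm, NCKernel.hasKernelFormula hO' hH hHreg hHherm,
    fun n m a ha c hc b _ => hf.ncDelta_diffDiff_le ha hc, fun n a ha c hc => hf.ncDeltaTilde_le ha hc,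
    fun htri n a ha c hc => ?_⟩
  have ha' := NCKernel.mem_positivitySet_of_mem_kernelDomain ha
  have hc' := NCKernel.mem_positivitySet_of_mem_kernelDomain hc
  have hfa := NCKernel.mem_positivitySet_of_mem_kernelDomain (hf.mapsTo n a ha)
  have hfc := NCKernel.mem_positivitySet_of_mem_kernelDomain (hf.mapsTo n c hc)
  have hform := (NCKernel.hasKernelFormula hO hG hGreg hGherm htri).2 n a ha c hc
  -- Lower bound for `δ̃` of `H`, contraction under `f`, then the exact formula for `G`.
  have hle : NCKernel.sqrtSupSpectrum (NCKernel.pickElement H (f n a) (f n c) - 1) ≤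
      NCKernel.sqrtSupSpectrum (NCKernel.pickElement G a c - 1) :=
    (NCKernel.sqrtSupSpectrum_pickElement_le hO' hH hHherm (hf.mapsTo n a ha)
      (hf.mapsTo n c hc)).trans ((hf.ncDeltaTilde_le ha hc).trans hform.le)
  have hG0 := NCKernel.pickElement_nonneg hGherm ha' hc'
  have hmax := NCKernel.norm_le_max_one_norm hG0 (NCKernel.pickElement_nonneg hHherm hfa hfc) hle
  refine ⟨hmax, ?_, ?_⟩
  · rintro (rfl | hne)
    · rw [NCKernel.pickElement_self ha', NCKernel.pickElement_self hfa]
      exact NCKernel.norm_one_cstarMatrix_le n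
    · rw [hform] at hne
      rwa [max_eq_right (NCKernel.one_le_norm_of_sqrtSupSpectrum_ne_zero hG0 hne)] at hmax
  · refine (NCKernel.crossTerm_sub_le_iff hfa _).2 ?_
    refine (NCKernel.le_smul_one_iff_sqrtSupSpectrum_le
      (NCKernel.isSelfAdjoint_pickElement_sub_one hHherm hfa hfc) (norm_nonneg _)).2 ?_
    exact hle.trans (NCKernel.sqrtSupSpectrum_le_sqrt_norm
      (NCKernel.isSelfAdjoint_pickElement_sub_one hGherm ha' hc'))
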